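/- An integral quadratic form in $r$ variables is a quadratic form $Q$ on $\mathbb{Z}^r$ with values in $\mathbb{Z}$ (cross terms may have odd coefficients). It represents $n$ if $Q(x)=n$ for some $x\in\mathbb{Z}^r$; it represents $n$ locally if $Q(x)=n$ is solvable in $\mathbb{Z}_q^r$ for every prime $q$; it is regular if it represents every positive integer that it represents locally. For a prime $p$, a positive-definite integral form is called coprime-universal with respect to $p$ if it represents every positive integer coprime to $p$. An escalator with respect to $p$ is a positive-definite form obtained from the zero-dimensional form by finitely many steps, each replacing a form $Q$ that is not coprime-universal by a positive-definite form whose lattice is generated by an isometric copy of the lattice of $Q$ and a vector of norm $t$, where $t$ is the least positive integer coprime to $p$ not represented by $Q$. (a) The following ternary forms are positive definite and regular, locally represent every positive integer coprime to the stated prime $p$, and hence are coprime-universal with respect to $p$: - $p=5$: $x^2+5xz+2y^2+yz+7z^2$, $\;x^2+4xz+2y^2+3yz+7z^2$, $\;x^2+4xz+2y^2+2yz+7z^2$, $\;x^2+2y^2+4yz+7z^2$, $\;x^2+xy+2xz+2y^2+3yz+3z^2$, $\;x^2+xy+2y^2+yz+3z^2$; - $p=7$: $x^2+4xz+2y^2+yz+5z^2$,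 $\;x^2+3xz+2y^2+yz+5z^2$; - $p=11$: $x^2+xz+y^2+3z^2$; - $p=13$: $x^2+3xz+2y^2+3yz+5z^2$; - $p=17$: $x^2+xy+xz+2y^2+2yz+3z^2$. (b) Let $p$ be a prime with $p=19$ or $p\ge 37$. Then every ternary escalator with respect to $p$ fails to represent some positive integer coprime to $p$, and no positive-definite integral ternary quadratic form is coprime-universal with respect to $p$. (c) For $p=2,3,5,7,11,13,17$ there exists a positive-definite integral ternary quadratic form that is coprime-universal with respect to $p$. (d) For $p=23$ (respectively $29$, $31$) such a form exists provided that the form $x^2+2xz+2y^2+3yz+5z^2$ (respectively $x^2+xz+2y^2+3yz+5z^2$, $\;x^2+2xz+2y^2+yz+5z^2$) represents every positive integer coprime to $p$, as is conjectured. -/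

import Mathlib

/-- An integral (integer-valued) quadratic form in `r` variables: a quadratic form on `ℤ^r` with
values in `ℤ`, so that odd cross-term coefficients are allowed. -/
abbrev IntForm (r : ℕ) : Type := QuadraticForm ℤ (Fin r → ℤ)

namespace IntForm

/-- The ternary form `a x² + b xy + c xz + d y² + e yz + f z²`. -/
noncomputable def ternary (a b c d e f : ℤ) : IntForm 3 :=
  a • QuadraticMap.proj 0 0 + b • QuadraticMap.proj 0 1 + c • QuadraticMap.proj 0 2 +
    d • QuadraticMap.proj 1 1 + e • QuadraticMap.proj 1 2 + f • QuadraticMap.proj 2 2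

theorem ternary_apply (a b c d e f : ℤ) (v : Fin 3 → ℤ) :
    ternary a b c d e f v =
      a * v 0 ^ 2 + b * (v 0 * v 1) + c * (v 0 * v 2) + d * v 1 ^ 2 + e * (v 1 * v 2) +
        f * v 2 ^ 2 := by
  simp [ternary, pow_two]

/-- The form represents the natural number `n` over the integers. -/
def Represents {r : ℕ} (Q : IntForm r) (n : ℕ) : Prop :=
  ∃ x : Fin r → ℤ, Q x = n

/-- The value at a vector of `R^r` of the homogeneous quadratic polynomial that defines `Q`:
the coefficient of `xᵢ²` is `Q(eᵢ)` and that of `xᵢ xⱼ` for `i < j` is `Q(eᵢ + eⱼ) - Q(eᵢ) - Q(eⱼ)`. -/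
def evalOver {r : ℕ} (Q : IntForm r) (R : Type) [CommRing R] (x : Fin r → R) : R :=
  ∑ i, ((Q (Pi.single i 1) : ℤ) : R) * x i ^ 2 +
    ∑ i, ∑ j ∈ Finset.Ioi i,
      ((QuadraticMap.polar Q (Pi.single i 1) (Pi.single j 1) : ℤ) : R) * (x i * x j)

/-- `n` is represented by `Q` over `ℤ_q` for every prime `q`. (For positive definite `Q` of positive
rank and positive `n` there is no further condition at the real place.) -/
def LocallyRepresents {r : ℕ} (Q : IntForm r) (n : ℕ) : Prop :=
  ∀ (q : ℕ) [Fact q.Prime], ∃ x : Fin r → ℤ_[q], Q.evalOver ℤ_[q] x = n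

/-- `Q` represents every positive integer that it represents locally. -/
def IsRegular {r : ℕ} (Q : IntForm r) : Prop :=
  ∀ n : ℕ, 0 < n → Q.LocallyRepresents n → Q.Represents n

/-- `Q` represents every positive integer coprime to `p`. -/
def CoprimeUniversal {r : ℕ} (p : ℕ) (Q : IntForm r) : Prop :=
  ∀ n : ℕ, 0 < n → n.Coprime p → Q.Represents n

/-- The positive integers coprime to `p` that `Q` does not represent. -/
def coprimeExceptions {r : ℕ} (p : ℕ) (Q : IntForm r) : Set ℕ :=
  {t | 0 < t ∧ t.Coprime p ∧ ¬ Q.Represents t}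

/-- `Q'` is an escalation of `Q` by `t`: the lattice of `Q'` is positive definite and is generated
by an isometric copy of the lattice of `Q` and a vector of norm `t`. -/
def IsEscalation {r r' : ℕ} (Q : IntForm r) (t : ℕ) (Q' : IntForm r') : Prop :=
  QuadraticMap.PosDef Q' ∧
    ∃ (f : (Fin r → ℤ) →ₗ[ℤ] (Fin r' → ℤ)) (v : Fin r' → ℤ),
      (∀ x, Q' (f x) = Q x) ∧ Q' v = t ∧ LinearMap.range f ⊔ Submodule.span ℤ {v} = ⊤

/-- The escalators with respect to `p`: the forms obtained from the zero-dimensional form by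
successively escalating by the truant, that is, by the least positive integer coprime to `p` that
is not represented. -/
inductive IsEscalator (p : ℕ) : {r : ℕ} → IntForm r → Prop
  | zero (Q : IntForm 0) : IsEscalator p Q
  | step {r r' : ℕ} (Q : IntForm r) (t : ℕ) (Q' : IntForm r') :
      IsEscalator p Q → IsLeast (coprimeExceptions p Q) t → IsEscalation Q t Q' →
      IsEscalator p Q'

/-- The ternary forms asserted to be coprime-universal, with their primes. -/
noncomputable def provenTable : List (ℕ × IntForm 3) :=
  [(5, ternary 1 0 5 2 1 7),
   (5, ternary 1 0 4 2 3 7),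
   (5, ternary 1 0 4 2 2 7),
   (5, ternary 1 0 0 2 4 7),
   (5, ternary 1 1 2 2 3 3),
   (5, ternary 1 1 0 2 1 3),
   (7, ternary 1 0 4 2 1 5),
   (7, ternary 1 0 3 2 1 5),
   (11, ternary 1 0 1 1 0 3),
   (13, ternary 1 0 3 2 3 5),
   (17, ternary 1 1 1 2 2 3)]

/-- The ternary forms conjectured to be coprime-universal, with their primes. -/
noncomputable def conjecturedTable : List (ℕ × IntForm 3) :=
  [(2, ternary 1 0 1 2 0 5),
   (2, ternary 1 1 0 3 2 6),
   (2, ternary 1 1 1 3 0 7),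
   (5, ternary 1 0 1 2 3 7),
   (5, ternary 1 0 0 2 1 7),
   (23, ternary 1 0 2 2 3 5),
   (29, ternary 1 0 1 2 3 5),
   (31, ternary 1 0 2 2 1 5)]

/-- The part for the prime `p` of the conjecture that the forms of `conjecturedTable` are
coprime-universal for the stated primes. -/
def ConjectureAt (p : ℕ) : Prop :=
  ∀ Q : IntForm 3, (p, Q) ∈ conjecturedTable → Q.CoprimeUniversal p

end IntForm

/-! For a small prime `p`, let `T` be a form of half-discriminant `p`. An integer `n` prime to `p`
is the leading coefficient of some positive definite form of discriminant `p`: Dirichlet's theorem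
supplies a prime `l = 4nd - 1` for which `-np` is a square mod `l`, and the discriminant condition
becomes `l f = n e² + p` (`exists_pos_disc_eq`). That form is equivalent to a reduced one, and `2adf
≤ disc` leaves finitely many reduced forms. Explicit matrices, some with denominator 2, carry the
values of each of them to `T` (`Classified.rep`). The tabulated forms of composite discriminant `pδ`
inherit their values by further rational similarities (`Transfer.rep`).

Regularity involves only the prime `p`. A similar construction represents `pm` whenever `-mδ` is a
nonresidue. Conversely, the section `z = 0` is anisotropic mod `p`, so a `p`-adically represented
multiple `pm` of `p` either satisfies this condition or has `p ∣ m`, and then the whole vector is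
divisible by `p` and descent applies (`RepresentsAllowed.rep_of_padic`).

For the negative part, a reduced form that represents 1, 2, 3 and 5 has bounded coefficients, and a
finite search finds an omitted integer in a list whose members are below 37 and prime to 19
(`Reduced.exists_not_rep`). -/

/-- Coefficients of the ternary form `a x² + b xy + c xz + d y² + e yz + f z²`. -/
structure TForm where
  a : ℤ
  b : ℤ
  c : ℤ
  d : ℤ
  e : ℤ
  f : ℤ

/-! ### Positive definite ternary forms and Minkowski reduction. -/

namespace TForm

/-- The value of the form at an integer vector. -/
def eval (G : TForm) (x y z : ℤ) : ℤ :=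
  G.a * x ^ 2 + G.b * (x * y) + G.c * (x * z) + G.d * y ^ 2 + G.e * (y * z) + G.f * z ^ 2

/-- The half-discriminant. -/
def disc (G : TForm) : ℤ :=
  4 * G.a * G.d * G.f + G.b * G.c * G.e - G.a * G.e ^ 2 - G.d * G.c ^ 2 - G.f * G.b ^ 2

/-- `n` is a value of the form. -/
def Rep (G : TForm) (n : ℤ) : Prop := ∃ x y z : ℤ, G.eval x y z = n

/-- Positive definiteness, in terms of the leading minors. -/
structure Pos (G : TForm) : Prop where
  a_pos : 0 < G.a
  minor_pos : 0 < 4 * G.a * G.d - G.b ^ 2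
  disc_pos : 0 < G.disc

theorem complete_squares (G : TForm) (x y z : ℤ) :
    4 * G.a * (4 * G.a * G.d - G.b ^ 2) * G.eval x y z =
      (4 * G.a * G.d - G.b ^ 2) * (2 * G.a * x + G.b * y + G.c * z) ^ 2 +
        ((4 * G.a * G.d - G.b ^ 2) * y + (2 * G.a * G.e - G.b * G.c) * z) ^ 2 +
        4 * G.a * G.disc * z ^ 2 := by
  simp only [eval, disc]; ring

theorem Pos.eval_pos {G : TForm} (hG : G.Pos) {x y z : ℤ} (h : ¬ (x = 0 ∧ y = 0 ∧ z = 0)) :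
    0 < G.eval x y z := by
  obtain ⟨h1, h2, h3⟩ := hG
  have key := G.complete_squares x y z
  have h4 : 0 < 4 * G.a * (4 * G.a * G.d - G.b ^ 2) := by positivity
  refine pos_of_mul_pos_right (a := 4 * G.a * (4 * G.a * G.d - G.b ^ 2)) ?_ h4.le
  rw [key]
  generalize 4 * G.a * G.d - G.b ^ 2 = D at *
  by_cases hz : z = 0
  · by_cases hy : y = 0
    · have hx : x ≠ 0 := fun hx => h ⟨hx, hy, hz⟩
      subst hz hy
      have : 0 < D * (2 * G.a * x + G.b * 0 + G.c * 0) ^ 2 := by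
        have : 2 * G.a * x + G.b * 0 + G.c * 0 ≠ 0 := by
          simp [hx, h1.ne']
        positivity
      positivity
    · subst hz
      have : 0 < (D * y + (2 * G.a * G.e - G.b * G.c) * 0) ^ 2 := by
        have : D * y + (2 * G.a * G.e - G.b * G.c) * 0 ≠ 0 := by
          simp [hy, h2.ne']
        positivity
      positivity
  · positivity

theorem pos_of_eval_pos {G : TForm}
    (h : ∀ x y z : ℤ, ¬ (x = 0 ∧ y = 0 ∧ z = 0) → 0 < G.eval x y z) : G.Pos := by
  have h1 : 0 < G.a := by
    have := h 1 0 0 (by simp)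
    simpa [eval] using this
  have h2 : 0 < 4 * G.a * G.d - G.b ^ 2 := by
    -- This vector is orthogonal to the first basis vector; the one used for `disc` below is the
    -- cross product of the first two rows of the Gram matrix, hence orthogonal to the first two
    -- basis vectors.
    have := h (-G.b) (2 * G.a) 0 (by intro h; omega)
    have e : G.eval (-G.b) (2 * G.a) 0 = G.a * (4 * G.a * G.d - G.b ^ 2) := by
      simp only [eval]; ring
    rw [e] at this
    exact pos_of_mul_pos_right this h1.le
  refine ⟨h1, h2, ?_⟩
  have := h (G.b * G.e - 2 * G.c * G.d) (G.b * G.c - 2 * G.a * G.e) (4 * G.a * G.d - G.b ^ 2)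
    (by intro h; omega)
  have e : G.eval (G.b * G.e - 2 * G.c * G.d) (G.b * G.c - 2 * G.a * G.e)
      (4 * G.a * G.d - G.b ^ 2) = (4 * G.a * G.d - G.b ^ 2) * G.disc := by
    simp only [eval, disc]; ring
  rw [e] at this
  exact pos_of_mul_pos_right this h2.le

/-- Two forms with the same values and the same discriminant, both positive definite or neither. -/
structure Similar (G H : TForm) : Prop where
  pos : G.Pos → H.Pos
  disc_eq : H.disc = G.disc
  rep_iff : ∀ n, H.Rep n ↔ G.Rep n

theorem Similar.refl (G : TForm) : G.Similar G := ⟨id, rfl, fun _ => Iff.rfl⟩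

theorem Similar.trans {G H K : TForm} (h₁ : G.Similar H) (h₂ : H.Similar K) : G.Similar K :=
  ⟨h₂.pos ∘ h₁.pos, h₂.disc_eq.trans h₁.disc_eq, fun n => (h₂.rep_iff n).trans (h₁.rep_iff n)⟩

/-- Forms that differ by an invertible substitution are similar. -/
theorem Similar.of_subst {G H : TForm} (σ τ : ℤ × ℤ × ℤ → ℤ × ℤ × ℤ)
    (hσ : ∀ x y z, H.eval x y z = G.eval (σ (x, y, z)).1 (σ (x, y, z)).2.1 (σ (x, y, z)).2.2)
    (hστ : ∀ v, σ (τ v) = v) (hτσ : ∀ v, τ (σ v) = v) (h0 : τ 0 = 0) (hd : H.disc = G.disc) :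
    G.Similar H := by
  refine ⟨fun hG => pos_of_eval_pos fun x y z hv => ?_, hd, fun n => ⟨?_, ?_⟩⟩
  · rw [hσ]
    refine hG.eval_pos fun h => hv ?_
    have h' : σ (x, y, z) = 0 := Prod.ext h.1 (Prod.ext h.2.1 h.2.2)
    have := hτσ (x, y, z)
    rw [h', h0] at this
    simpa [Prod.ext_iff, eq_comm] using this
  · rintro ⟨x, y, z, h⟩
    exact ⟨_, _, _, (hσ x y z).symm.trans h⟩
  · rintro ⟨x, y, z, h⟩
    refine ⟨(τ (x, y, z)).1, (τ (x, y, z)).2.1, (τ (x, y, z)).2.2, ?_⟩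
    rw [hσ, hστ]
    exact h

theorem similar_swap₁₂ (G : TForm) : G.Similar ⟨G.d, G.b, G.e, G.a, G.c, G.f⟩ :=
  .of_subst (fun v => (v.2.1, v.1, v.2.2)) (fun v => (v.2.1, v.1, v.2.2))
    (fun x y z => by simp only [eval]; ring) (fun _ => rfl) (fun _ => rfl) rfl
    (by simp only [disc]; ring)

theorem similar_swap₂₃ (G : TForm) : G.Similar ⟨G.a, G.c, G.b, G.f, G.e, G.d⟩ :=
  .of_subst (fun v => (v.1, v.2.2, v.2.1)) (fun v => (v.1, v.2.2, v.2.1))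
    (fun x y z => by simp only [eval]; ring) (fun _ => rfl) (fun _ => rfl) rfl
    (by simp only [disc]; ring)

theorem similar_neg₁ (G : TForm) : G.Similar ⟨G.a, -G.b, -G.c, G.d, G.e, G.f⟩ :=
  .of_subst (fun v => (-v.1, v.2.1, v.2.2)) (fun v => (-v.1, v.2.1, v.2.2))
    (fun x y z => by simp only [eval]; ring) (fun _ => by simp) (fun _ => by simp) (by simp)
    (by simp only [disc]; ring)

theorem similar_neg₂ (G : TForm) : G.Similar ⟨G.a, -G.b, G.c, G.d, -G.e, G.f⟩ :=
  .of_subst (fun v => (v.1, -v.2.1, v.2.2)) (fun v => (v.1, -v.2.1, v.2.2))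
    (fun x y z => by simp only [eval]; ring) (fun _ => by simp) (fun _ => by simp) (by simp)
    (by simp only [disc]; ring)

theorem similar_shear₂ (G : TForm) (s : ℤ) :
    G.Similar ⟨G.a, G.b + 2 * G.a * s, G.c, G.d + s * G.b + s ^ 2 * G.a, G.e + s * G.c, G.f⟩ :=
  .of_subst (fun v => (v.1 + s * v.2.1, v.2.1, v.2.2)) (fun v => (v.1 - s * v.2.1, v.2.1, v.2.2))
    (fun x y z => by simp only [eval]; ring) (fun _ => by simp) (fun _ => by simp) (by simp)
    (by simp only [disc]; ring)

theorem similar_shear₃ (G : TForm) (s t : ℤ) :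
    G.Similar ⟨G.a, G.b, G.c + 2 * G.a * s + G.b * t, G.d, G.e + 2 * G.d * t + G.b * s,
      G.f + s * G.c + t * G.e + s ^ 2 * G.a + t ^ 2 * G.d + s * t * G.b⟩ :=
  .of_subst (fun v => (v.1 + s * v.2.2, v.2.1 + t * v.2.2, v.2.2))
    (fun v => (v.1 - s * v.2.2, v.2.1 - t * v.2.2, v.2.2))
    (fun x y z => by simp only [eval]; ring) (fun _ => by simp) (fun _ => by simp) (by simp)
    (by simp only [disc]; ring)

/-- Minkowski-reduced forms with normalized signs. -/
structure Reduced (G : TForm) : Prop where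
  a_pos : 0 < G.a
  a_le_d : G.a ≤ G.d
  d_le_f : G.d ≤ G.f
  b_le : |G.b| ≤ G.a
  c_le : |G.c| ≤ G.a
  e_le : |G.e| ≤ G.d
  signs : (0 ≤ G.b ∧ 0 ≤ G.c ∧ 0 ≤ G.e) ∨
    (G.b ≤ 0 ∧ G.c ≤ 0 ∧ G.e ≤ 0 ∧ 0 ≤ G.a + G.d + G.b + G.c + G.e)

/-- Minimize `a + d + f` over the similar forms. Permutations and sign changes preserve this sum, so
a minimizer can be sorted and normalized; minimality against the shears by `±1` gives the remaining
inequalities. -/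
theorem Pos.exists_reduced {G : TForm} (hG : G.Pos) : ∃ H : TForm, G.Similar H ∧ H.Reduced := by
  classical
  have posd : ∀ {H : TForm}, H.Pos → 0 < H.d ∧ 0 < H.f := fun {H} hH =>
    ⟨by simpa [eval] using hH.eval_pos (x := 0) (y := 1) (z := 0) (by simp),
      by simpa [eval] using hH.eval_pos (x := 0) (y := 0) (z := 1) (by simp)⟩
  have hex : ∃ m : ℕ, ∃ H : TForm, G.Similar H ∧ H.a + H.d + H.f = m := by
    obtain ⟨h1, h2⟩ := posd hG
    exact ⟨(G.a + G.d + G.f).toNat, G, .refl G, by have := hG.a_pos; omega⟩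
  obtain ⟨H₀, hH₀, hm₀⟩ := Nat.find_spec hex
  have hmin : ∀ H : TForm, G.Similar H → (Nat.find hex : ℤ) ≤ H.a + H.d + H.f := by
    intro H hH
    obtain ⟨h1, h2⟩ := posd (hH.pos hG)
    have h3 := (hH.pos hG).a_pos
    have := Nat.find_min' hex ⟨H, hH, (show H.a + H.d + H.f = ((H.a + H.d + H.f).toNat : ℤ) by omega)⟩
    omega
  generalize (Nat.find hex : ℤ) = m at hm₀ hmin
  let P : TForm → Prop := fun H => G.Similar H ∧ H.a + H.d + H.f = m
  have step : ∀ {H K : TForm}, P H → H.Similar K → K.a + K.d + K.f = H.a + H.d + H.f → P K :=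
    fun hH hK h => ⟨hH.1.trans hK, h.trans hH.2⟩
  -- sort the diagonal
  obtain ⟨H₁, hH₁, had₁⟩ : ∃ H, P H ∧ H.a ≤ H.d ∧ H.a ≤ H.f := by
    have h0 : P H₀ := ⟨hH₀, hm₀⟩
    have h1 : P ⟨H₀.d, H₀.b, H₀.e, H₀.a, H₀.c, H₀.f⟩ :=
      step h0 H₀.similar_swap₁₂ (by ring)
    have h2 : P ⟨H₀.a, H₀.c, H₀.b, H₀.f, H₀.e, H₀.d⟩ :=
      step h0 H₀.similar_swap₂₃ (by ring)
    have h3 := step h2 (similar_swap₁₂ _) (by ring)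
    rcases le_total H₀.a H₀.d with h | h <;> rcases le_total H₀.a H₀.f with h' | h' <;>
      rcases le_total H₀.d H₀.f with h'' | h''
    · exact ⟨_, h0, h, h'⟩
    · exact ⟨_, h0, h, h'⟩
    · exact ⟨_, h3, h', by dsimp only; omega⟩
    · exact ⟨_, h3, h', by dsimp only; omega⟩
    · exact ⟨_, h1, h, by dsimp only; omega⟩
    · exact ⟨_, h1, h, by dsimp only; omega⟩
    · exact ⟨_, h1, h, by dsimp only; omega⟩
    · exact ⟨_, h3, h', by dsimp only; omega⟩
  obtain ⟨H₂, hH₂, had₂, hdf₂⟩ : ∃ H, P H ∧ H.a ≤ H.d ∧ H.d ≤ H.f := by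
    rcases le_total H₁.d H₁.f with h | h
    · exact ⟨_, hH₁, had₁.1, h⟩
    · exact ⟨_, step hH₁ H₁.similar_swap₂₃ (by ring), had₁.2, h⟩
  -- normalize the signs
  obtain ⟨H, hH, had, hdf, hs⟩ : ∃ H, P H ∧ H.a ≤ H.d ∧ H.d ≤ H.f ∧
      ((0 ≤ H.b ∧ 0 ≤ H.c ∧ 0 ≤ H.e) ∨ (H.b ≤ 0 ∧ H.c ≤ 0 ∧ H.e ≤ 0)) := by
    have h1 := step hH₂ H₂.similar_neg₁ (by ring)
    have h2 := step hH₂ H₂.similar_neg₂ (by ring)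
    have h3 := step h1 (similar_neg₂ _) (by ring)
    rcases le_total H₂.b 0 with hb | hb <;> rcases le_total H₂.c 0 with hc | hc <;>
      rcases le_total H₂.e 0 with he | he
    · exact ⟨_, hH₂, had₂, hdf₂, by omega⟩
    · exact ⟨_, h1, had₂, hdf₂, by dsimp only; omega⟩
    · exact ⟨_, h2, had₂, hdf₂, by dsimp only; omega⟩
    · exact ⟨_, h3, had₂, hdf₂, by dsimp only; omega⟩
    · exact ⟨_, h3, had₂, hdf₂, by dsimp only; omega⟩
    · exact ⟨_, h2, had₂, hdf₂, by dsimp only; omega⟩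
    · exact ⟨_, h1, had₂, hdf₂, by dsimp only; omega⟩
    · exact ⟨_, hH₂, had₂, hdf₂, by omega⟩
  -- Each shear alters a single diagonal entry, so minimality reads `a ± b ≥ 0`, `a ± c ≥ 0`, `d ± e
  -- ≥ 0` and `a + d + b + c + e ≥ 0`.
  have hb₁ := hmin _ (hH.1.trans (H.similar_shear₂ 1))
  have hb₂ := hmin _ (hH.1.trans (H.similar_shear₂ (-1)))
  have hc₁ := hmin _ (hH.1.trans (H.similar_shear₃ 1 0))
  have hc₂ := hmin _ (hH.1.trans (H.similar_shear₃ (-1) 0))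
  have he₁ := hmin _ (hH.1.trans (H.similar_shear₃ 0 1))
  have he₂ := hmin _ (hH.1.trans (H.similar_shear₃ 0 (-1)))
  have hsum := hmin _ (hH.1.trans (H.similar_shear₃ 1 1))
  have hm := hH.2
  dsimp only at hb₁ hb₂ hc₁ hc₂ he₁ he₂ hsum
  refine ⟨H, hH.1, (hH.1.pos hG).a_pos, had, hdf, ?_, ?_, ?_, ?_⟩
  · rw [abs_le]; constructor <;> linarith
  · rw [abs_le]; constructor <;> linarith
  · rw [abs_le]; constructor <;> linarith
  · rcases hs with hs | hs
    · exact .inl hs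
    · exact .inr ⟨hs.1, hs.2.1, hs.2.2, by linarith⟩

/-- Gauss's bound, with equality at `⟨1, 1, 1, 1, 1, 1⟩`. Since `disc - 2adf` increases with `f`,
the case `f = d` decides; there the difference is a sum of products of factors that reduction makes
nonnegative. -/
theorem Reduced.two_mul_le_disc {G : TForm} (hG : G.Reduced) :
    2 * G.a * G.d * G.f ≤ G.disc := by
  obtain ⟨ha, had, hdf, hb, hc, he, hs⟩ := hG
  obtain ⟨a, b, c, d, e, f⟩ := G
  simp only [disc] at *
  have hb2 : b ^ 2 ≤ a ^ 2 := sq_le_sq' (abs_le.1 hb).1 (abs_le.1 hb).2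
  have hc2 : c ^ 2 ≤ a ^ 2 := sq_le_sq' (abs_le.1 hc).1 (abs_le.1 hc).2
  rw [abs_le] at hb hc he
  have hd : 0 < d := by linarith
  have haad : a ^ 2 ≤ a * d := by nlinarith
  have hf : 0 ≤ (f - d) * (2 * a * d - b ^ 2) := mul_nonneg (by linarith) (by nlinarith)
  rcases hs with ⟨hb0, hc0, he0⟩ | ⟨hb0, hc0, he0, hsum⟩
  · have h1 : 0 ≤ (d - e) * (2 * a * d - b ^ 2 - c ^ 2) := mul_nonneg (by linarith) (by linarith)
    have h2 : b ^ 2 - b * c + c ^ 2 ≤ a ^ 2 := by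
      rcases le_total b c with h | h
      · nlinarith [mul_nonneg hb0 (sub_nonneg.2 h)]
      · nlinarith [mul_nonneg hc0 (sub_nonneg.2 h)]
    have h3 : 0 ≤ e * (a * d - b ^ 2 + b * c - c ^ 2) := mul_nonneg he0 (by linarith)
    have h4 : 0 ≤ a * (e * (d - e)) := mul_nonneg ha.le (mul_nonneg he0 (by linarith))
    nlinarith
  · obtain ⟨β, rfl⟩ : ∃ β, b = -β := ⟨-b, by ring⟩
    obtain ⟨γ, rfl⟩ : ∃ γ, c = -γ := ⟨-c, by ring⟩
    obtain ⟨ε, rfl⟩ : ∃ ε, e = -ε := ⟨-e, by ring⟩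
    have hβ : 0 ≤ β := by linarith
    have hγ : 0 ≤ γ := by linarith
    have hε : 0 ≤ ε := by linarith
    have hβγ := mul_nonneg hβ hγ
    suffices h : 0 ≤ 2 * a * d ^ 2 - d * β ^ 2 - β * γ * ε - a * ε ^ 2 - d * γ ^ 2 by nlinarith
    by_cases hs : β + γ ≤ a
    · have h1 : β ^ 2 + γ ^ 2 + β * γ ≤ a ^ 2 := by nlinarith
      have h2 : 0 ≤ β * γ * (d - ε) := mul_nonneg hβγ (by linarith)
      have h3 : 0 ≤ a * ((d - ε) * (d + ε)) :=
        mul_nonneg ha.le (mul_nonneg (by linarith) (by linarith))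
      have h4 : 0 ≤ d * (a * d - β ^ 2 - γ ^ 2 - β * γ) := mul_nonneg hd.le (by linarith)
      nlinarith
    -- The required expression is exactly the sum of the five products `h1` to `h5`.
    · have h1 : 0 ≤ β * γ * (a + d - β - γ - ε) := mul_nonneg hβγ (by linarith)
      have h2 : 0 ≤ a * ((a + d - β - γ - ε) * (a + d - β - γ + ε)) :=
        mul_nonneg ha.le (mul_nonneg (by linarith) (by linarith))
      have h3 : 0 ≤ (a - β) * (a - γ) * (d + (β + γ - a)) :=
        mul_nonneg (mul_nonneg (by linarith) (by linarith)) (by linarith)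
      have h4 : 0 ≤ a * d * (d - a) := mul_nonneg (mul_pos ha hd).le (by linarith)
      have h5 : 0 ≤ d * ((β + γ - a) * (a - (β + γ - a))) :=
        mul_nonneg hd.le (mul_nonneg (by linarith) (by linarith))
      nlinarith

end TForm

/-! ### Forms of prime discriminant with prescribed leading coefficient. -/

/-- The character `J(m | ·)` for `m > 0` is even. -/
theorem jacobiSym_eq_of_dvd_add {m u v : ℕ} (hm : 0 < m) (hu : Odd u) (hv : Odd v)
    (h : 4 * m ∣ u + v) : jacobiSym m u = jacobiSym m v := by
  have hodd : Odd (4 * m - 1) := Nat.Even.sub_odd (by omega) ⟨2 * m, by ring⟩ odd_one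
  -- `4m ≡ 1` mod `4m - 1`, and 4 is a square. Modulo `4m`, multiplication by `4m - 1` is negation.
  have h1 : jacobiSym m (4 * m - 1) = 1 := by
    have h5 : jacobiSym (4 * m) (4 * m - 1) = 1 := by
      rw [jacobiSym.mod_left' (a₂ := 1), jacobiSym.one_left]
      have : ((4 * m - 1 : ℕ) : ℤ) = 4 * m - 1 := by omega
      rw [this]
      exact Int.ModEq.symm (Int.modEq_iff_dvd.2 dvd_rfl)
    rwa [jacobiSym.mul_left, jacobiSym.at_four hodd, one_mul] at h5
  have h2 : jacobiSym m ((4 * m - 1) * v) = jacobiSym m v := by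
    rw [jacobiSym.mul_right' _ (by omega) (by rintro rfl; simp at hv), h1, one_mul]
  rw [← h2, jacobiSym.mod_right _ hu, jacobiSym.mod_right _ (hodd.mul hv), Int.natAbs_natCast]
  congr 1
  refine Nat.ModEq.add_right_cancel' v ?_
  have h3 : (4 * m - 1) * v + v = 4 * m * v := by
    rw [← Nat.succ_mul]; congr 1; omega
  rw [h3]
  exact ((Nat.modEq_zero_iff_dvd.2 h).trans (Nat.modEq_zero_iff_dvd.2 ⟨v, rfl⟩).symm)

theorem exists_mul_eq_mul_sq_add {l : ℕ} (hl : l.Prime) {n k : ℤ}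
    (h : jacobiSym (-(n * k)) l = 1) : ∃ e f : ℤ, l * f = n * e ^ 2 + k := by
  have := Fact.mk hl
  have hn : (n : ZMod l) ≠ 0 := by
    intro hn
    rw [ZMod.intCast_zmod_eq_zero_iff_dvd] at hn
    have h0 : jacobiSym (-(n * k)) l = 0 := by
      rw [jacobiSym.mod_left, Int.emod_eq_zero_of_dvd ((hn.mul_right k).neg_right),
        jacobiSym.zero_left hl.one_lt]
    omega
  obtain ⟨s, hs⟩ := ZMod.isSquare_of_jacobiSym_eq_one h
  -- With `s² = -nk` mod `l`, the choice `e = s / n` gives `n e² = -k`.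
  obtain ⟨e, he⟩ := ZMod.intCast_surjective (s / (n : ZMod l))
  have : ((n * e ^ 2 + k : ℤ) : ZMod l) = 0 := by
    push_cast
    push_cast at hs
    rw [he]
    field_simp
    linear_combination -hs
  obtain ⟨f, hf⟩ := (ZMod.intCast_zmod_eq_zero_iff_dvd _ _).1 this
  exact ⟨e, f, hf.symm⟩

namespace TForm

/-- If `r ≡ 3 mod 4` and `J(p | r) = -1`, every positive `n` prime to `p` is the leading coefficient
of a positive definite form of discriminant `p`. -/
theorem exists_pos_disc_eq {p r n : ℕ} (hp : p.Prime) (hr4 : r % 4 = 3)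
    (hr : jacobiSym p r = -1) (hn : 0 < n) (hpn : ¬ p ∣ n) :
    ∃ G : TForm, G.Pos ∧ G.disc = p ∧ G.a = n := by
  have hgcd : Nat.gcd (4 * n) (4 * p) = 4 := by
    rw [Nat.gcd_mul_left, (Nat.coprime_comm.1 ((hp.coprime_iff_not_dvd).2 hpn)), mul_one]
  have hrodd : Odd r := Nat.odd_iff.2 (by omega)
  have hcompat : 4 * n - 1 ≡ r [MOD Nat.gcd (4 * n) (4 * p)] := by
    rw [hgcd]; unfold Nat.ModEq; omega
  -- The prime `l` is to be `-1` mod `4n` and `r` mod `4p`; both residues are 3 mod 4, the only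
  -- compatibility needed.
  obtain ⟨a, ha1, ha2⟩ := Nat.chineseRemainder' hcompat
  have hc1 : a.Coprime (4 * n) := by
    have : Nat.Coprime (4 * n - 1) (4 * n) := by
      have := Nat.coprime_self_add_right (m := 4 * n - 1) (n := 1)
      rw [Nat.sub_add_cancel (by omega)] at this
      exact this.2 (Nat.coprime_one_right _)
    exact ha1.gcd_eq.trans this
  have hrp : r.Coprime p := by
    have : ¬ jacobiSym p r = 0 := by omega
    rw [jacobiSym.eq_zero_iff] at this
    push Not at this
    have := this (by omega)
    rw [Int.gcd_natCast_natCast] at this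
    exact Nat.coprime_comm.1 this
  have hc2 : a.Coprime (4 * p) := by
    refine ha2.gcd_eq.trans ?_
    refine Nat.Coprime.mul_right ?_ hrp
    exact (Nat.Coprime.pow_right 2 (Nat.coprime_comm.1 hrodd.coprime_two_left) :)
  obtain ⟨l, -, hl, hla⟩ := Nat.forall_exists_prime_gt_and_modEq 0
    (q := Nat.lcm (4 * n) (4 * p)) (a := a) (Nat.lcm_ne_zero (by omega) (by have := hp.pos; omega))
    (Nat.Coprime.coprime_dvd_right (Nat.lcm_dvd_mul _ _) (hc1.mul_right hc2))
  have hl1 : l ≡ 4 * n - 1 [MOD 4 * n] := (hla.of_dvd (Nat.dvd_lcm_left _ _)).trans ha1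
  have hl2 : l ≡ r [MOD 4 * p] := (hla.of_dvd (Nat.dvd_lcm_right _ _)).trans ha2
  have hdvd : 4 * n ∣ l + 1 := by
    rw [← Nat.modEq_zero_iff_dvd]
    refine (hl1.add_right 1).trans ?_
    rw [Nat.sub_add_cancel (by omega)]
    exact Nat.modEq_zero_iff_dvd.2 dvd_rfl
  obtain ⟨d, hd⟩ := hdvd
  have hl4 : l % 4 = 3 := by
    rw [mul_assoc] at hd; omega
  have hlodd : Odd l := Nat.odd_iff.2 (by omega)
  have hJn : jacobiSym n l = 1 := by
    rw [jacobiSym_eq_of_dvd_add hn hlodd odd_one ⟨d, hd⟩, jacobiSym.one_right]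
  have hJp : jacobiSym p l = -1 := by
    rw [← hr, jacobiSym.mod_right' _ hlodd, jacobiSym.mod_right' _ hrodd]
    exact congrArg _ hl2
  -- The signs are `J(-1 | l) = -1`, `J(n | l) = 1` and `J(p | l) = -1`.
  have hJ : jacobiSym (-(n * p)) l = 1 := by
    rw [jacobiSym.neg _ hlodd, jacobiSym.mul_left, hJn, hJp, ZMod.χ₄_nat_three_mod_four hl4]
    norm_num
  obtain ⟨e, f, hef⟩ := exists_mul_eq_mul_sq_add hl hJ
  have hd' : (l : ℤ) = 4 * n * d - 1 := by
    have : (l : ℤ) + 1 = 4 * n * d := by exact_mod_cast hd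
    linarith
  -- The discriminant is `(4nd - 1) f - n e² = l f - n e²`.
  have hdisc : disc ⟨n, 1, 0, d, e, f⟩ = p := by
    simp only [disc]
    linear_combination hef - f * hd'
  refine ⟨⟨n, 1, 0, d, e, f⟩, ⟨?_, ?_, ?_⟩, hdisc, rfl⟩
  · exact Int.natCast_pos.2 hn
  · have : (0 : ℤ) < l := by exact_mod_cast hl.pos
    dsimp only; linarith
  · rw [hdisc]; exact_mod_cast hp.pos

/-- If `p` is an odd prime and `-m` is a nonresidue mod `p`, then `pm` is the leading coefficient of
a positive definite form of discriminant `p`. -/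
theorem exists_pos_disc_eq_of_mul {p m : ℕ} (hp : p.Prime) (hp2 : Odd p) (hm : 0 < m)
    (hJ : jacobiSym (-m) p = -1) : ∃ G : TForm, G.Pos ∧ G.disc = p ∧ G.a = p * m := by
  have hpm : p.Coprime (4 * m) := by
    refine Nat.Coprime.mul_right ?_ ?_
    · exact (Nat.Coprime.pow_right 2 (Nat.coprime_comm.1 hp2.coprime_two_left) :)
    · have : ¬ jacobiSym (-m) p = 0 := by omega
      rw [jacobiSym.eq_zero_iff] at this
      push Not at this
      have := this hp.ne_zero
      rw [Int.neg_gcd, Int.gcd_natCast_natCast] at this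
      exact Nat.coprime_comm.1 this
  have hc : ((4 * m - 1) * p).Coprime (4 * m) := by
    refine Nat.Coprime.mul_left ?_ hpm
    have := Nat.coprime_self_add_right (m := 4 * m - 1) (n := 1)
    rw [Nat.sub_add_cancel (by omega)] at this
    exact this.2 (Nat.coprime_one_right _)
  -- Here `l ≡ -p` mod `4m`. Then `J(m | l) = J(m | p)`, while `-1` has opposite characters at `l`
  -- and `p`, so `J(-m | l) = -J(-m | p) = 1`.
  obtain ⟨l, -, hl, hla⟩ := Nat.forall_exists_prime_gt_and_modEq 0 (by omega) hc
  have hdvd : 4 * m ∣ l + p := by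
    rw [← Nat.modEq_zero_iff_dvd]
    refine (hla.add_right p).trans ?_
    rw [← Nat.succ_mul, Nat.succ_eq_add_one, Nat.sub_add_cancel (by omega)]
    exact Nat.modEq_zero_iff_dvd.2 ⟨p, rfl⟩
  obtain ⟨d, hd⟩ := hdvd
  have hlodd : Odd l := by
    rw [Nat.odd_iff] at hp2 ⊢
    rw [mul_assoc] at hd; omega
  have hχ : ZMod.χ₄ l = - ZMod.χ₄ p := by
    rw [mul_assoc] at hd
    rw [Nat.odd_iff] at hp2
    have : p % 4 = 1 ∨ p % 4 = 3 := by omega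
    rcases this with h | h
    · rw [ZMod.χ₄_nat_one_mod_four h, ZMod.χ₄_nat_three_mod_four (by omega)]
    · rw [ZMod.χ₄_nat_three_mod_four h, ZMod.χ₄_nat_one_mod_four (by omega)]; rfl
  have hJ' : jacobiSym (-(m * 1)) l = 1 := by
    rw [mul_one, jacobiSym.neg _ hlodd, hχ, jacobiSym_eq_of_dvd_add hm hlodd hp2 ⟨d, hd⟩]
    rw [jacobiSym.neg _ hp2] at hJ
    linarith
  obtain ⟨e, f, hef⟩ := exists_mul_eq_mul_sq_add hl hJ'
  have hd' : (l : ℤ) = 4 * m * d - p := by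
    have : (l : ℤ) + p = 4 * m * d := by exact_mod_cast hd
    linarith
  have hp0 : (0 : ℤ) < p := by exact_mod_cast hp.pos
  -- The discriminant is `p (l f - m e²)` with `l = 4md - p`.
  have hdisc : disc ⟨p * m, p, 0, d, e, f⟩ = p := by
    simp only [disc]
    linear_combination p * hef - p * f * hd'
  refine ⟨⟨p * m, p, 0, d, e, f⟩, ⟨?_, ?_, ?_⟩, hdisc, rfl⟩
  · exact mul_pos hp0 (by exact_mod_cast hm)
  · have : (0 : ℤ) < p * l := mul_pos hp0 (by exact_mod_cast hl.pos)
    rw [hd'] at this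
    dsimp only; linarith
  · rw [hdisc]; exact hp0

end TForm

/-! ### Transfer of values by rational similarities. -/

/-- A 3 × 3 integer matrix, by rows. -/
structure IntMat where
  m₁₁ : ℤ
  m₁₂ : ℤ
  m₁₃ : ℤ
  m₂₁ : ℤ
  m₂₂ : ℤ
  m₂₃ : ℤ
  m₃₁ : ℤ
  m₃₂ : ℤ
  m₃₃ : ℤ

namespace IntMat

/-- First coordinate of the image of a vector. -/
def fst (M : IntMat) (x y z : ℤ) : ℤ := M.m₁₁ * x + M.m₁₂ * y + M.m₁₃ * z

/-- Second coordinate of the image of a vector. -/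
def snd (M : IntMat) (x y z : ℤ) : ℤ := M.m₂₁ * x + M.m₂₂ * y + M.m₂₃ * z

/-- Third coordinate of the image of a vector. -/
def thd (M : IntMat) (x y z : ℤ) : ℤ := M.m₃₁ * x + M.m₃₂ * y + M.m₃₃ * z

/-- The image of the vector `(x, y, z)` is divisible by `k`. -/
def DvdAt (M : IntMat) (k x y z : ℤ) : Prop := k ∣ M.fst x y z ∧ k ∣ M.snd x y z ∧ k ∣ M.thd x y z

instance (M : IntMat) (k x y z : ℤ) : Decidable (M.DvdAt k x y z) :=
  inferInstanceAs (Decidable (_ ∧ _ ∧ _))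

theorem DvdAt.add_mul {M : IntMat} {k x y z : ℤ} (h : M.DvdAt k x y z) (u v w : ℤ) :
    M.DvdAt k (x + k * u) (y + k * v) (z + k * w) := by
  obtain ⟨⟨r, hr⟩, ⟨s, hs⟩, ⟨t, ht⟩⟩ := h
  simp only [fst, snd, thd] at hr hs ht
  refine ⟨⟨r + M.fst u v w, ?_⟩, ⟨s + M.snd u v w, ?_⟩, ⟨t + M.thd u v w, ?_⟩⟩ <;>
    simp only [fst, snd, thd]
  · linear_combination hr
  · linear_combination hs
  · linear_combination ht

end IntMat

namespace TForm

instance : DecidableEq TForm := fun G H =>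
  decidable_of_iff
    (G.a = H.a ∧ G.b = H.b ∧ G.c = H.c ∧ G.d = H.d ∧ G.e = H.e ∧ G.f = H.f)
    (by cases G; cases H; simp)

/-- The form `T (M v)`. -/
def pull (T : TForm) (M : IntMat) : TForm where
  a := T.eval M.m₁₁ M.m₂₁ M.m₃₁
  b := T.eval (M.m₁₁ + M.m₁₂) (M.m₂₁ + M.m₂₂) (M.m₃₁ + M.m₃₂) - T.eval M.m₁₁ M.m₂₁ M.m₃₁ -
    T.eval M.m₁₂ M.m₂₂ M.m₃₂
  c := T.eval (M.m₁₁ + M.m₁₃) (M.m₂₁ + M.m₂₃) (M.m₃₁ + M.m₃₃) - T.eval M.m₁₁ M.m₂₁ M.m₃₁ -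
    T.eval M.m₁₃ M.m₂₃ M.m₃₃
  d := T.eval M.m₁₂ M.m₂₂ M.m₃₂
  e := T.eval (M.m₁₂ + M.m₁₃) (M.m₂₂ + M.m₂₃) (M.m₃₂ + M.m₃₃) - T.eval M.m₁₂ M.m₂₂ M.m₃₂ -
    T.eval M.m₁₃ M.m₂₃ M.m₃₃
  f := T.eval M.m₁₃ M.m₂₃ M.m₃₃

theorem eval_pull (T : TForm) (M : IntMat) (x y z : ℤ) :
    (T.pull M).eval x y z = T.eval (M.fst x y z) (M.snd x y z) (M.thd x y z) := by
  simp only [pull, eval, IntMat.fst, IntMat.snd, IntMat.thd]; ring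

/-- The multiple of a form by an integer. -/
def scale (c : ℤ) (T : TForm) : TForm := ⟨c * T.a, c * T.b, c * T.c, c * T.d, c * T.e, c * T.f⟩

theorem eval_scale (c : ℤ) (T : TForm) (x y z : ℤ) :
    (scale c T).eval x y z = c * T.eval x y z := by
  simp only [scale, eval]; ring

theorem dvd_eval_add_mul_sub (S : TForm) (k u v w x y z : ℤ) :
    k ∣ S.eval (x + k * u) (y + k * v) (z + k * w) - S.eval x y z := by
  refine ⟨S.a * (2 * x * u + k * u ^ 2) + S.b * (x * v + u * y + k * u * v) +
    S.c * (x * w + u * z + k * u * w) + S.d * (2 * y * v + k * v ^ 2) +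
    S.e * (y * w + v * z + k * v * w) + S.f * (2 * z * w + k * w ^ 2), ?_⟩
  simp only [eval]; ring

/-- The rational maps `k⁻¹ M` for `M` in the list multiply the form by `c⁻¹`, and each integer vector
at which `S` is divisible by `c` has an integral image under one of them. -/
def Transfer (S T : TForm) (c : ℤ) (k : ℕ) (Ms : List IntMat) : Prop :=
  k ≠ 0 ∧ c ≠ 0 ∧ c ∣ k ∧ (∀ M ∈ Ms, scale c (T.pull M) = scale (k ^ 2) S) ∧
    ∀ x ∈ List.range k, ∀ y ∈ List.range k, ∀ z ∈ List.range k,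
      c ∣ S.eval x y z → ∃ M ∈ Ms, M.DvdAt k x y z

instance (S T : TForm) (c : ℤ) (k : ℕ) (Ms : List IntMat) : Decidable (Transfer S T c k Ms) :=
  inferInstanceAs (Decidable (_ ∧ _ ∧ _ ∧ _ ∧ _))

/-- Integrality of `k⁻¹ M v` depends only on `v` mod `k`, and so does divisibility of `S v` by `c`,
because `c ∣ k`. Checking residues therefore covers all vectors. -/
theorem Transfer.rep {S T : TForm} {c : ℤ} {k : ℕ} {Ms : List IntMat} (h : Transfer S T c k Ms)
    {n : ℤ} (hn : S.Rep (c * n)) : T.Rep n := by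
  obtain ⟨hk, hc, hck, hM, hres⟩ := h
  obtain ⟨x, y, z, hv⟩ := hn
  have hk0 : (k : ℤ) ≠ 0 := by exact_mod_cast hk
  have key : ∀ x : ℤ, ∃ r ∈ List.range k, ∃ u : ℤ, x = (r : ℤ) + k * u := by
    intro x
    have h1 := Int.emod_nonneg x hk0
    have h2 := Int.emod_lt_of_pos x (b := k) (by omega)
    refine ⟨(x % k).toNat, List.mem_range.2 (by omega), x / k, ?_⟩
    rw [Int.toNat_of_nonneg h1]
    exact (Int.emod_add_mul_ediv x k).symm
  obtain ⟨r, hr, u, rfl⟩ := key x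
  obtain ⟨s, hs, v, rfl⟩ := key y
  obtain ⟨t, ht, w, rfl⟩ := key z
  have hdvd : c ∣ S.eval r s t := by
    have h1 := hck.trans (S.dvd_eval_add_mul_sub k u v w r s t)
    rw [hv] at h1
    exact (dvd_sub_right (dvd_mul_right c n)).1 h1
  obtain ⟨M, hMs, hMd⟩ := hres r hr s hs t ht hdvd
  obtain ⟨⟨x', hx⟩, ⟨y', hy⟩, ⟨z', hz⟩⟩ := hMd.add_mul u v w
  refine ⟨x', y', z', ?_⟩
  have h1 := congrArg (fun G : TForm => G.eval (r + k * u) (s + k * v) (t + k * w)) (hM M hMs)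
  simp only [eval_scale, eval_pull, hx, hy, hz, hv] at h1
  have h2 : T.eval (k * x') (k * y') (k * z') = k ^ 2 * T.eval x' y' z' := by
    simp only [eval]; ring
  rw [h2] at h1
  have h3 : (c * k ^ 2) * T.eval x' y' z' = (c * k ^ 2) * n := by linear_combination h1
  exact mul_left_cancel₀ (by positivity) h3

/-! ### Reduced forms of small prime discriminant. -/

instance (G : TForm) : Decidable G.Reduced :=
  decidable_of_iff
    (0 < G.a ∧ G.a ≤ G.d ∧ G.d ≤ G.f ∧ (-G.a ≤ G.b ∧ G.b ≤ G.a) ∧ (-G.a ≤ G.c ∧ G.c ≤ G.a) ∧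
      (-G.d ≤ G.e ∧ G.e ≤ G.d) ∧ ((0 ≤ G.b ∧ 0 ≤ G.c ∧ 0 ≤ G.e) ∨
        (G.b ≤ 0 ∧ G.c ≤ 0 ∧ G.e ≤ 0 ∧ 0 ≤ G.a + G.d + G.b + G.c + G.e)))
    ⟨fun ⟨h1, h2, h3, h4, h5, h6, h7⟩ =>
      ⟨h1, h2, h3, abs_le.2 h4, abs_le.2 h5, abs_le.2 h6, h7⟩,
      fun ⟨h1, h2, h3, h4, h5, h6, h7⟩ =>
      ⟨h1, h2, h3, abs_le.1 h4, abs_le.1 h5, abs_le.1 h6, h7⟩⟩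

/-- The list contains all reduced forms of discriminant `p < 18`, each with data that transfer its
values to `T`. -/
def Classified (p : ℤ) (T : TForm) (L : List (TForm × ℕ × List IntMat)) : Prop :=
  p < 18 ∧ (∀ E ∈ L, Transfer E.1 T 1 E.2.1 E.2.2) ∧
    ∀ a ∈ Finset.Icc (1 : ℤ) 2, ∀ d ∈ Finset.Icc (1 : ℤ) 2, ∀ f ∈ Finset.Icc (1 : ℤ) 8,
      2 * a * d * f ≤ p →
      ∀ b ∈ Finset.Icc (-2 : ℤ) 2, ∀ c ∈ Finset.Icc (-2 : ℤ) 2, ∀ e ∈ Finset.Icc (-2 : ℤ) 2,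
        disc ⟨a, b, c, d, e, f⟩ = p → Reduced ⟨a, b, c, d, e, f⟩ →
          ⟨a, b, c, d, e, f⟩ ∈ L.map Prod.fst

noncomputable instance (p : ℤ) (T : TForm) (L : List (TForm × ℕ × List IntMat)) :
    Decidable (Classified p T L) :=
  inferInstanceAs (Decidable (_ ∧ _ ∧ _))

theorem Classified.rep {p : ℤ} {T : TForm} {L : List (TForm × ℕ × List IntMat)}
    (h : Classified p T L) {G : TForm} (hG : G.Pos) (hd : G.disc = p) {n : ℤ} (hn : G.Rep n) :
    T.Rep n := by
  obtain ⟨hp, hL, hmem⟩ := h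
  obtain ⟨H, hGH, hH⟩ := hG.exists_reduced
  have hn' := (hGH.rep_iff n).2 hn
  have hHd : H.disc = p := hGH.disc_eq.trans hd
  have hle := hH.two_mul_le_disc
  rw [hHd] at hle
  obtain ⟨a, b, c, d, e, f⟩ := H
  have hH' := hH
  obtain ⟨ha, had, hdf, hb, hc, he, -⟩ := hH'
  dsimp only at ha had hdf hb hc he hle
  -- If `d ≥ 3` then `2adf ≥ 18 > p`; likewise `f ≥ 9` is excluded.
  have hd2 : d ≤ 2 := by
    by_contra hcon
    have h1 : 3 * 3 ≤ d * f := by nlinarith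
    nlinarith
  have hf8 : f ≤ 8 := by
    have : 1 ≤ a * d := by nlinarith
    nlinarith
  rw [abs_le] at hb hc he
  have := hmem a (Finset.mem_Icc.2 ⟨by omega, by omega⟩) d (Finset.mem_Icc.2 ⟨by omega, by omega⟩)
    f (Finset.mem_Icc.2 ⟨by omega, by omega⟩) hle b (Finset.mem_Icc.2 ⟨by omega, by omega⟩)
    c (Finset.mem_Icc.2 ⟨by omega, by omega⟩) e (Finset.mem_Icc.2 ⟨by omega, by omega⟩) hHd hH
  obtain ⟨E, hE, hEe⟩ := List.mem_map.1 this
  exact (hL E hE).rep (by rwa [hEe, one_mul])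

theorem classified_two : Classified 2 ⟨1, 1, 1, 1, 1, 1⟩
  [(⟨1, -1, -1, 1, 0, 1⟩, 1, [⟨-1, 0, 1, 0, 0, -1, 0, 1, 0⟩]),
   (⟨1, -1, 0, 1, -1, 1⟩, 1, [⟨-1, 0, 0, 0, 0, 1, 0, 1, -1⟩]),
   (⟨1, 0, -1, 1, -1, 1⟩, 1, [⟨-1, 0, 0, 0, -1, 1, 0, 1, 0⟩]),
   (⟨1, 0, 1, 1, 1, 1⟩, 1, [⟨-1, 0, 0, 0, -1, -1, 0, 1, 0⟩]),
   (⟨1, 1, 0, 1, 1, 1⟩, 1, [⟨-1, 0, 0, 0, -1, -1, 0, 0, 1⟩]),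
   (⟨1, 1, 1, 1, 0, 1⟩, 1, [⟨-1, -1, 0, 0, 0, -1, 0, 1, 0⟩]),
   (⟨1, 1, 1, 1, 1, 1⟩, 1, [⟨-1, 0, 0, 0, -1, 0, 0, 0, -1⟩])] := by
  decide +kernel

theorem classified_three : Classified 3 ⟨1, 1, 0, 1, 0, 1⟩
  [(⟨1, -1, 0, 1, 0, 1⟩, 1, [⟨-1, 0, 0, 0, 1, 0, 0, 0, -1⟩]),
   (⟨1, 0, -1, 1, 0, 1⟩, 1, [⟨-1, 0, 0, 0, 0, 1, 0, -1, 0⟩]),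
   (⟨1, 0, 0, 1, -1, 1⟩, 1, [⟨0, -1, 0, 0, 0, 1, -1, 0, 0⟩]),
   (⟨1, 0, 0, 1, 1, 1⟩, 1, [⟨0, -1, 0, 0, 0, -1, -1, 0, 0⟩]),
   (⟨1, 0, 1, 1, 0, 1⟩, 1, [⟨-1, 0, 0, 0, 0, -1, 0, -1, 0⟩]),
   (⟨1, 1, 0, 1, 0, 1⟩, 1, [⟨-1, 0, 0, 0, -1, 0, 0, 0, -1⟩])] := by
  decide +kernel

theorem classified_five : Classified 5 ⟨1, 0, 5, 2, 1, 7⟩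
  [(⟨1, -1, -1, 1, 0, 2⟩, 1, [⟨-2, -1, 0, 0, 0, -1, 1, 0, 0⟩]),
   (⟨1, -1, 0, 1, -1, 2⟩, 1, [⟨-1, -2, 0, 0, 0, -1, 0, 1, 0⟩]),
   (⟨1, 1, 0, 1, 1, 2⟩, 1, [⟨-1, 2, 0, 0, 0, -1, 0, -1, 0⟩]),
   (⟨1, 1, 1, 1, 0, 2⟩, 1, [⟨-2, 1, 0, 0, 0, 1, 1, 0, 0⟩]),
   (⟨1, 1, 1, 1, 1, 2⟩, 1, [⟨-3, -2, 0, 0, 0, 1, 1, 1, 0⟩])] := by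
  decide +kernel

theorem classified_seven : Classified 7 ⟨1, 0, 4, 2, 1, 5⟩
  [(⟨1, 0, -1, 1, 0, 2⟩, 1, [⟨-2, -1, 0, 0, 0, -1, 1, 0, 0⟩]),
   (⟨1, 0, 0, 1, -1, 2⟩, 1, [⟨-1, -2, 0, 0, 0, -1, 0, 1, 0⟩]),
   (⟨1, 0, 0, 1, 1, 2⟩, 1, [⟨-1, -2, 0, 0, 0, 1, 0, 1, 0⟩]),
   (⟨1, 0, 1, 1, 0, 2⟩, 1, [⟨-2, -1, 0, 0, 0, 1, 1, 0, 0⟩])] := by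
  decide +kernel

/-- The forms with diagonal `(1, 1, 4)` use three matrices of denominator 2, which together cover
all residues mod 2; the others use a unimodular matrix. -/
theorem classified_eleven : Classified 11 ⟨1, 0, 1, 1, 0, 3⟩
  [(⟨1, 0, -1, 1, 0, 3⟩, 1, [⟨-1, 0, 0, 0, -1, 0, 0, 0, 1⟩]),
   (⟨1, 0, 0, 1, -1, 3⟩, 1, [⟨0, -1, 0, -1, 0, 0, 0, 0, 1⟩]),
   (⟨1, 0, 0, 1, 1, 3⟩, 1, [⟨0, -1, 0, -1, 0, 0, 0, 0, -1⟩]),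
   (⟨1, 0, 1, 1, 0, 3⟩, 1, [⟨-1, 0, 0, 0, -1, 0, 0, 0, -1⟩]),
   (⟨1, -1, -1, 1, 0, 4⟩, 2, [⟨0, 0, 4, -1, 2, 0, -1, 0, 0⟩,
     ⟨0, -1, -3, -2, 1, 1, 0, 1, -1⟩,
     ⟨0, 0, -4, -1, -1, 1, -1, 1, 1⟩]),
   (⟨1, -1, 0, 1, -1, 4⟩, 2, [⟨0, 0, 4, -2, 1, 0, 0, -1, 0⟩,
     ⟨-1, 0, -3, -1, 2, -1, 1, 0, -1⟩,
     ⟨0, 0, 4, -1, -1, 1, -1, 1, -1⟩]),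
   (⟨1, 1, 0, 1, 1, 4⟩, 2, [⟨0, 0, -4, -2, -1, 0, 0, -1, 0⟩,
     ⟨-1, 0, -3, -1, -2, -1, 1, 0, -1⟩,
     ⟨0, 0, 4, -1, 1, 1, -1, -1, -1⟩]),
   (⟨1, 1, 1, 1, 0, 4⟩, 2, [⟨0, 0, -4, -1, -2, 0, -1, 0, 0⟩,
     ⟨0, -1, -3, -2, -1, -1, 0, 1, -1⟩,
     ⟨0, 0, 4, -1, 1, -1, -1, -1, -1⟩]),
   (⟨1, 1, 1, 1, 1, 4⟩, 2, [⟨0, 0, -4, -1, 1, 0, -1, -1, 0⟩,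
     ⟨-1, 0, 3, -1, -2, -1, 1, 0, 1⟩,
     ⟨0, -1, 3, -2, -1, -1, 0, 1, 1⟩])] := by
  decide +kernel

theorem classified_thirteen : Classified 13 ⟨1, 0, 3, 2, 3, 5⟩
  [(⟨1, -1, 0, 2, -1, 2⟩, 1, [⟨-1, -1, 0, 0, -1, 1, 0, 1, 0⟩]),
   (⟨1, 0, -1, 2, -1, 2⟩, 1, [⟨-1, 0, -1, 0, 1, -1, 0, 0, 1⟩]),
   (⟨1, 0, 1, 2, 1, 2⟩, 1, [⟨-1, 0, 1, 0, 1, 1, 0, 0, -1⟩]),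
   (⟨1, 1, 0, 2, 1, 2⟩, 1, [⟨-1, 1, 0, 0, 1, 1, 0, -1, 0⟩])] := by
  decide +kernel

theorem classified_seventeen : Classified 17 ⟨1, 1, 1, 2, 2, 3⟩
  [(⟨1, -1, -1, 1, 0, 6⟩, 2, [⟨-2, 1, -1, 0, -1, 3, 0, 1, 1⟩,
     ⟨-1, -1, -1, -1, 1, 3, 1, -1, 1⟩,
     ⟨-1, 2, 2, -1, 0, -2, 1, 0, -2⟩]),
   (⟨1, -1, 0, 1, -1, 6⟩, 2, [⟨-1, 2, 1, 1, 0, -3, -1, 0, -1⟩,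
     ⟨-2, 1, 2, 0, -1, -2, 0, 1, -2⟩,
     ⟨-1, -1, -1, 1, -1, 3, -1, 1, 1⟩]),
   (⟨1, 1, 0, 1, 1, 6⟩, 2, [⟨-1, -2, 1, 1, 0, -3, -1, 0, -1⟩,
     ⟨-2, -1, -2, 0, -1, 2, 0, 1, 2⟩,
     ⟨-1, 1, -1, 1, 1, 3, -1, -1, 1⟩]),
   (⟨1, 1, 1, 1, 0, 6⟩, 2, [⟨-2, -1, 1, 0, 1, -3, 0, -1, -1⟩,
     ⟨-1, -2, -2, -1, 0, 2, 1, 0, 2⟩,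
     ⟨-1, 1, 1, -1, -1, -3, 1, 1, -1⟩]),
   (⟨1, 1, 1, 1, 1, 6⟩, 2, [⟨-2, -1, 1, 0, -1, -3, 0, 1, -1⟩,
     ⟨-1, -2, 1, -1, 0, -3, 1, 0, -1⟩,
     ⟨-1, 1, -2, -1, -1, 2, 1, 1, 2⟩]),
   (⟨1, -1, -1, 2, -1, 3⟩, 1, [⟨-1, 0, 1, 0, 1, 0, 0, 0, -1⟩]),
   (⟨1, -1, 0, 2, -2, 3⟩, 1, [⟨-1, 0, 0, 0, 1, -1, 0, 0, 1⟩]),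
   (⟨1, 1, 0, 2, 2, 3⟩, 1, [⟨-1, 0, 0, 0, -1, -1, 0, 0, 1⟩]),
   (⟨1, 1, 1, 2, 2, 3⟩, 1, [⟨-1, 0, 0, 0, -1, 0, 0, 0, -1⟩])] := by
  decide +kernel

/-- This and the next transfers derive the tabulated forms of composite discriminant from those of
discriminant 5 and 7, the last step for 40 passing through 10. -/
theorem transfer_fifteen : Transfer ⟨1, 0, 5, 2, 1, 7⟩ ⟨1, 0, 4, 2, 3, 7⟩ 3 6
  [⟨-2, 4, 0, -2, -2, -4, 0, 0, -2⟩,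
   ⟨-2, -4, -2, 2, -2, 6, 0, 0, -2⟩,
   ⟨-4, 2, -6, 0, 4, 2, 2, -2, 4⟩,
   ⟨-1, -1, 2, 0, -4, 0, -1, 1, -4⟩,
   ⟨-1, 1, -7, 0, 4, 0, -1, -1, -1⟩,
   ⟨-4, -2, -7, 0, -4, 0, 2, 2, 5⟩] := by
  decide +kernel

theorem transfer_ten : Transfer ⟨1, 0, 5, 2, 1, 7⟩ ⟨1, 1, 2, 2, 3, 3⟩ 2 2
  [⟨0, -1, 1, -1, 1, -2, 0, -1, -1⟩,
   ⟨-1, 2, -2, 0, 0, 1, 1, 0, 2⟩,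
   ⟨0, 1, -1, -1, -1, -3, 0, 1, 1⟩] := by
  decide +kernel

theorem transfer_twenty : Transfer ⟨1, 0, 5, 2, 1, 7⟩ ⟨1, 0, 4, 2, 2, 7⟩ 1 2
  [⟨-2, 0, -3, 0, -2, 0, 0, 0, -1⟩,
   ⟨-1, 3, 0, 0, 2, 0, 1, -1, 2⟩,
   ⟨-1, -3, -5, 0, -2, 0, 1, 1, 3⟩] := by
  decide +kernel

theorem transfer_twenty_nonclassical : Transfer ⟨1, 0, 5, 2, 1, 7⟩ ⟨1, 1, 0, 2, 1, 3⟩ 1 4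
  [⟨-2, 0, -2, 0, 4, 0, 2, 0, 6⟩,
   ⟨-2, 0, -8, 0, -4, 0, 2, 0, 4⟩,
   ⟨-4, -2, -10, 0, 4, 0, 0, -2, -2⟩,
   ⟨-1, 1, 1, -2, 2, -6, -1, -3, -3⟩,
   ⟨-1, -1, -6, -2, -2, -4, -1, 3, -2⟩,
   ⟨-4, 2, -9, 0, -4, -2, 0, 2, -1⟩] := by
  decide +kernel

theorem transfer_forty : Transfer ⟨1, 1, 2, 2, 3, 3⟩ ⟨1, 0, 0, 2, 4, 7⟩ 1 4
  [⟨-4, -2, -4, 0, 0, -4, 0, -2, 0⟩,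
   ⟨-3, 2, -1, 0, 0, 4, -1, -2, -3⟩,
   ⟨-3, -3, -1, -2, 2, -2, 1, 1, 3⟩,
   ⟨-3, 0, -5, -2, -4, -2, 1, 0, -1⟩,
   ⟨-3, -5, -5, 0, 0, -4, -1, 1, 1⟩] := by
  decide +kernel

theorem transfer_twentyOne : Transfer ⟨1, 0, 4, 2, 1, 5⟩ ⟨1, 0, 3, 2, 1, 5⟩ 3 3
  [⟨-1, 0, 0, -1, 1, -2, 0, -1, -1⟩,
   ⟨-1, 2, 0, -1, -1, -2, 0, 0, -1⟩,
   ⟨-1, -2, -1, 1, -1, 2, 0, 0, -1⟩,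
   ⟨-1, 0, -4, -1, -1, -2, 0, 1, 1⟩] := by
  decide +kernel

/-! ### Passage to `IntForm` and the integers represented. -/

theorem represents_ternary_iff (a b c d e f : ℤ) (n : ℕ) :
    (IntForm.ternary a b c d e f).Represents n ↔ Rep ⟨a, b, c, d, e, f⟩ n := by
  constructor
  · rintro ⟨v, hv⟩
    exact ⟨v 0, v 1, v 2, by rw [← hv, IntForm.ternary_apply]; rfl⟩
  · rintro ⟨x, y, z, h⟩
    exact ⟨![x, y, z], by rw [← h, IntForm.ternary_apply]; rfl⟩

theorem Pos.posDef_ternary {a b c d e f : ℤ} (h : Pos ⟨a, b, c, d, e, f⟩) :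
    QuadraticMap.PosDef (IntForm.ternary a b c d e f) := by
  intro v hv
  rw [IntForm.ternary_apply]
  refine h.eval_pos (x := v 0) (y := v 1) (z := v 2) fun h0 => hv ?_
  ext i
  fin_cases i
  exacts [h0.1, h0.2.1, h0.2.2]

theorem evalOver_ternary (a b c d e f : ℤ) (R : Type) [CommRing R] (v : Fin 3 → R) :
    (IntForm.ternary a b c d e f).evalOver R v =
      a * v 0 ^ 2 + b * (v 0 * v 1) + c * (v 0 * v 2) + d * v 1 ^ 2 + e * (v 1 * v 2) +
        f * v 2 ^ 2 := by
  have h0 : Finset.Ioi (0 : Fin 3) = {1, 2} := by decide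
  have h1 : Finset.Ioi (1 : Fin 3) = {2} := by decide
  have h2 : Finset.Ioi (2 : Fin 3) = ∅ := by decide
  simp [IntForm.evalOver, Fin.sum_univ_three, h0, h1, h2, QuadraticMap.polar,
    IntForm.ternary_apply]
  ring

theorem locallyRepresents_of_represents {a b c d e f : ℤ} {n : ℕ}
    (h : (IntForm.ternary a b c d e f).Represents n) :
    (IntForm.ternary a b c d e f).LocallyRepresents n := by
  intro q _
  obtain ⟨v, hv⟩ := h
  refine ⟨fun i => v i, ?_⟩
  rw [evalOver_ternary]
  rw [IntForm.ternary_apply] at hv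
  exact_mod_cast congrArg (Int.cast : ℤ → ℤ_[q]) hv

/-- The form `T` represents the positive integers prime to `p`, and the integers `pm` for which
`-mδ` is a nonresidue mod `p`. -/
structure RepresentsAllowed (p δ : ℕ) (T : TForm) : Prop where
  of_not_dvd : ∀ n : ℕ, 0 < n → ¬ p ∣ n → T.Rep n
  of_mul : ∀ m : ℕ, 0 < m → jacobiSym (-(m * δ)) p = -1 → T.Rep (p * m)

theorem Classified.representsAllowed {p r : ℕ} {T : TForm} {L : List (TForm × ℕ × List IntMat)}
    (h : Classified p T L) (hp : p.Prime) (hp2 : Odd p) (hr4 : r % 4 = 3)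
    (hr : jacobiSym p r = -1) : RepresentsAllowed p 1 T := by
  refine ⟨fun n hn hpn => ?_, fun m hm hJ => ?_⟩
  · obtain ⟨G, hG, hd, ha⟩ := exists_pos_disc_eq hp hr4 hr hn hpn
    exact h.rep hG hd ⟨1, 0, 0, by simp [eval, ha]⟩
  · obtain ⟨G, hG, hd, ha⟩ := exists_pos_disc_eq_of_mul hp hp2 hm (by simpa using hJ)
    exact h.rep hG hd ⟨1, 0, 0, by simp [eval, ha]⟩

/-- Representing `n` by `T` costs representing `cn` by `S`, so the factor `c` enters the residue
condition. -/
theorem RepresentsAllowed.transfer {p δ c k : ℕ} {S T : TForm} {Ms : List IntMat}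
    (hS : RepresentsAllowed p δ S) (h : Transfer S T c k Ms) (hp : p.Prime) (hc : ¬ p ∣ c) :
    RepresentsAllowed p (c * δ) T := by
  have hc0 : 0 < c := Nat.pos_of_ne_zero fun h => hc (h ▸ dvd_zero p)
  refine ⟨fun n hn hpn => h.rep ?_, fun m hm hJ => h.rep ?_⟩
  · have := hS.of_not_dvd (c * n) (by positivity) (fun hd => (hp.dvd_mul.1 hd).elim hc hpn)
    exact_mod_cast this
  · have := hS.of_mul (c * m) (by positivity) (by
      rw [← hJ]; congr 1; push_cast; ring)
    convert this using 1
    push_cast; ring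

/-- A residue symbol ignores the square 4. This brings `δ` into line with the discriminant `pδ`
after a transfer with `c = 1`. -/
theorem RepresentsAllowed.four_mul {p δ : ℕ} {T : TForm} (h : RepresentsAllowed p δ T)
    (hp2 : Odd p) : RepresentsAllowed p (4 * δ) T := by
  refine ⟨h.of_not_dvd, fun m hm hJ => h.of_mul m hm ?_⟩
  have : (-(m * (4 * δ : ℕ)) : ℤ) = 4 * (-(m * δ)) := by push_cast; ring
  rwa [this, jacobiSym.mul_left, jacobiSym.at_four hp2, one_mul] at hJ

end TForm

/-! ### Regularity from the condition at `p`. -/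

theorem PadicInt.toZMod_eq_zero_iff_dvd {p : ℕ} [Fact p.Prime] (x : ℤ_[p]) :
    PadicInt.toZMod x = 0 ↔ (p : ℤ_[p]) ∣ x := by
  rw [← RingHom.mem_ker, PadicInt.ker_toZMod, PadicInt.maximalIdeal_eq_span_p,
    Ideal.mem_span_singleton]

namespace TForm

/-- A `p`-adically represented integer is represented, provided the binary section `z = 0` of the
form is anisotropic mod `p`. -/
theorem RepresentsAllowed.rep_of_padic {p δ : ℕ} [hp : Fact p.Prime] (hp2 : Odd p)
    {b c d e f : ℤ} (hdisc : disc ⟨1, b, c, d, e, f⟩ = p * δ) (hδ : ¬ p ∣ δ)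
    (hD : jacobiSym (-(4 * d - b ^ 2)) p = -1)
    (hT : RepresentsAllowed p δ ⟨1, b, c, d, e, f⟩) (n : ℕ) (hn : 0 < n)
    (h : ∃ x y z : ℤ_[p],
      x ^ 2 + b * (x * y) + c * (x * z) + d * y ^ 2 + e * (y * z) + f * z ^ 2 = n) :
    Rep ⟨1, b, c, d, e, f⟩ n := by
  induction n using Nat.strong_induction_on with
  | _ n ih =>
  by_cases hpn : p ∣ n
  swap
  · exact hT.of_not_dvd n hn hpn
  obtain ⟨m, rfl⟩ := hpn
  obtain ⟨x, y, z, hv⟩ := h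
  have hm : 0 < m := Nat.pos_of_mul_pos_left hn
  have hp0 : (p : ℤ_[p]) ≠ 0 := Nat.cast_ne_zero.2 hp.out.ne_zero
  have h2 : (2 : ZMod p) ≠ 0 := by
    have : ((2 : ℕ) : ZMod p) ≠ 0 := by
      rw [Ne, ZMod.natCast_eq_zero_iff]
      intro h
      have := (Nat.prime_dvd_prime_iff_eq hp.out Nat.prime_two).1 h
      rw [this] at hp2
      exact absurd hp2 (by decide)
    exact_mod_cast this
  have hδ0 : (δ : ZMod p) ≠ 0 := by rwa [Ne, ZMod.natCast_eq_zero_iff]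
  have hns := ZMod.nonsquare_of_jacobiSym_eq_neg_one hD
  obtain ⟨D, hDdef⟩ : ∃ D : ℤ, D = 4 * d - b ^ 2 := ⟨_, rfl⟩
  rw [← hDdef] at hns
  have hns' : ∀ u v : ZMod p, D * u ^ 2 + v ^ 2 = 0 → u = 0 := by
    intro u v huv
    by_contra hu
    refine hns ⟨v / u, ?_⟩
    push_cast
    field_simp
    linear_combination -huv
  have hD0 : (D : ZMod p) ≠ 0 := fun h0 => hns ⟨0, by simp [h0]⟩
  have hdiscp : (4 * d * f + b * c * e - e ^ 2 - d * c ^ 2 - f * b ^ 2 : ℤ_[p]) = p * δ := by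
    have := congrArg (Int.cast : ℤ → ℤ_[p]) hdisc
    simp only [disc] at this
    push_cast at this
    linear_combination this
  have hDp : (D : ℤ_[p]) = 4 * d - b ^ 2 := by rw [hDdef]; push_cast; ring
  push_cast at hv
  obtain ⟨X, hX⟩ : ∃ X : ℤ_[p], X = 2 * x + b * y + c * z := ⟨_, rfl⟩
  obtain ⟨Y, hY⟩ : ∃ Y : ℤ_[p], Y = D * y + (2 * e - b * c) * z := ⟨_, rfl⟩
  have key : 4 * D * (p * m : ℤ_[p]) = D * X ^ 2 + Y ^ 2 + 4 * (p * δ) * z ^ 2 := by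
    rw [← hv, ← hdiscp, hX, hY, hDp]; ring
  -- Mod `p` only `D X² + Y² = 0` survives, and `-D` is a nonresidue, so `p` divides `X` and `Y`.
  -- Dividing `key` by `p` then yields `D m ≡ δ z²`.
  have hred := congrArg PadicInt.toZMod key
  simp only [map_add, map_mul, map_pow, map_intCast, map_natCast, CharP.cast_eq_zero,
    zero_mul, mul_zero, add_zero] at hred
  have hX0 := hns' _ _ hred.symm
  have hY0 : PadicInt.toZMod Y = 0 := by
    rw [hX0] at hred
    simpa using hred.symm
  obtain ⟨X', hX'⟩ := (PadicInt.toZMod_eq_zero_iff_dvd X).1 hX0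
  obtain ⟨Y', hY'⟩ := (PadicInt.toZMod_eq_zero_iff_dvd Y).1 hY0
  have key2 : 4 * D * (m : ℤ_[p]) = p * (D * X' ^ 2 + Y' ^ 2) + 4 * δ * z ^ 2 := by
    apply mul_left_cancel₀ hp0
    rw [hX', hY'] at key
    linear_combination key
  have hred2 := congrArg PadicInt.toZMod key2
  simp only [map_add, map_mul, map_pow, map_intCast, map_natCast, CharP.cast_eq_zero,
    zero_mul, zero_add, map_ofNat] at hred2
  have h4 : (4 : ZMod p) ≠ 0 := by
    have : (4 : ZMod p) = 2 * 2 := by norm_num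
    rw [this]; exact mul_ne_zero h2 h2
  have hred3 : (D : ZMod p) * m = δ * (PadicInt.toZMod z) ^ 2 := by
    apply mul_left_cancel₀ h4
    linear_combination hred2
  -- If `p ∣ m`, then `z`, `y`, `x` are successively divisible by `p`, and induction applies to `n /
  -- p²`.
  by_cases hpm : p ∣ m
  · have hz0 : PadicInt.toZMod z = 0 := by
      rw [(ZMod.natCast_eq_zero_iff m p).2 hpm, mul_zero] at hred3
      simpa [hδ0] using hred3.symm
    have hy0 : PadicInt.toZMod y = 0 := by
      have := congrArg PadicInt.toZMod hY
      simp only [map_add, map_mul, map_intCast, hY0, hz0, mul_zero, add_zero] at this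
      simpa [hD0] using this.symm
    have hx0 : PadicInt.toZMod x = 0 := by
      have := congrArg PadicInt.toZMod hX
      simp only [map_add, map_mul, map_intCast, map_ofNat, hX0, hy0, hz0, mul_zero,
        add_zero] at this
      simpa [h2] using this.symm
    obtain ⟨x', rfl⟩ := (PadicInt.toZMod_eq_zero_iff_dvd x).1 hx0
    obtain ⟨y', rfl⟩ := (PadicInt.toZMod_eq_zero_iff_dvd y).1 hy0
    obtain ⟨z', rfl⟩ := (PadicInt.toZMod_eq_zero_iff_dvd z).1 hz0
    obtain ⟨k, rfl⟩ := hpm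
    have hk : 0 < k := Nat.pos_of_mul_pos_left hm
    have hlt : k < p * (p * k) := by
      have := hp.out.two_le
      nlinarith
    obtain ⟨r, s, t, hrst⟩ := ih k hlt hk ⟨x', y', z', by
      apply mul_left_cancel₀ (mul_ne_zero hp0 hp0)
      push_cast at hv
      linear_combination hv⟩
    refine ⟨p * r, p * s, p * t, ?_⟩
    push_cast
    rw [← hrst]
    simp only [eval]
    ring
  · have hm0 : (m : ZMod p) ≠ 0 := by rwa [Ne, ZMod.natCast_eq_zero_iff]
    have := hT.of_mul m hm (ZMod.nonsquare_iff_jacobiSym_eq_neg_one.2 ?_)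
    · exact_mod_cast this
    -- From `-mδ = s²` and `D m = δ z²` follows `D m² + (s z)² = 0`, against anisotropy.
    rintro ⟨s, hs⟩
    push_cast at hs
    refine hm0 (hns' m (s * PadicInt.toZMod z) ?_)
    linear_combination (m : ZMod p) * hred3 - PadicInt.toZMod z ^ 2 * hs

/-- The form is positive definite and regular, and represents the positive integers prime to `p`
locally and globally. -/
theorem RepresentsAllowed.properties {p δ : ℕ} (hp : p.Prime) (hp2 : Odd p)
    {b c d e f : ℤ} (hT : RepresentsAllowed p δ ⟨1, b, c, d, e, f⟩)
    (hdisc : disc ⟨1, b, c, d, e, f⟩ = p * δ) (hδ : ¬ p ∣ δ)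
    (hD0 : 0 < 4 * d - b ^ 2) (hD : jacobiSym (-(4 * d - b ^ 2)) p = -1) :
    QuadraticMap.PosDef (IntForm.ternary 1 b c d e f) ∧ (IntForm.ternary 1 b c d e f).IsRegular ∧
      (∀ n : ℕ, 0 < n → n.Coprime p → (IntForm.ternary 1 b c d e f).LocallyRepresents n) ∧
      IntForm.CoprimeUniversal p (IntForm.ternary 1 b c d e f) := by
  have hu : IntForm.CoprimeUniversal p (IntForm.ternary 1 b c d e f) := fun n hn hc =>
    (represents_ternary_iff _ _ _ _ _ _ _).2
      (hT.of_not_dvd n hn ((Nat.Prime.coprime_iff_not_dvd hp).1 hc.symm))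
  refine ⟨Pos.posDef_ternary ⟨one_pos, by simpa using hD0, ?_⟩, fun n hn hloc => ?_,
    fun n hn hc => locallyRepresents_of_represents (hu n hn hc), hu⟩
  · rw [hdisc]
    have : 0 < δ := Nat.pos_of_ne_zero fun h => hδ (h ▸ dvd_zero p)
    have := hp.pos
    positivity
  · have := Fact.mk hp
    obtain ⟨v, hv⟩ := hloc p
    rw [evalOver_ternary] at hv
    rw [represents_ternary_iff]
    exact hT.rep_of_padic hp2 hdisc hδ hD n hn ⟨v 0, v 1, v 2, by simpa using hv⟩

/-! ### Small integers omitted by every ternary form. -/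

/-- Drop the first two squares in `complete_squares` and use `4ad - b² ≤ 4ad`. The hypotheses avoid
`Reduced` so that the variables may be permuted. -/
theorem mul_sq_le_two_mul_eval {G : TForm} (ha : 0 < G.a) (hd : 0 < G.d) (hf : 0 < G.f)
    (hD : 0 < 4 * G.a * G.d - G.b ^ 2) (hdisc : 2 * G.a * G.d * G.f ≤ G.disc) (x y z : ℤ) :
    G.f * z ^ 2 ≤ 2 * G.eval x y z := by
  have key := G.complete_squares x y z
  have h0 : 0 ≤ 2 * G.a * G.d * (G.f * z ^ 2) := by positivity
  have h1 : 2 * G.a * G.d * (G.f * z ^ 2) ≤ G.disc * z ^ 2 := by nlinarith [sq_nonneg z]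
  have h2 : 4 * G.a * (G.disc * z ^ 2) ≤
      4 * G.a * ((4 * G.a * G.d - G.b ^ 2) * G.eval x y z) := by
    have := mul_nonneg hD.le (sq_nonneg (2 * G.a * x + G.b * y + G.c * z))
    nlinarith [sq_nonneg ((4 * G.a * G.d - G.b ^ 2) * y + (2 * G.a * G.e - G.b * G.c) * z)]
  have h3 := le_of_mul_le_mul_left h2 (by positivity)
  have h4 : 0 ≤ G.eval x y z := nonneg_of_mul_nonneg_right (h0.trans (h1.trans h3)) hD
  have h5 : 2 * G.a * G.d * (G.f * z ^ 2) ≤ 2 * G.a * G.d * (2 * G.eval x y z) := by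
    nlinarith [mul_nonneg (sq_nonneg G.b) h4]
  exact le_of_mul_le_mul_left h5 (by positivity)

theorem Reduced.coord_bounds {G : TForm} (hG : G.Reduced) (x y z : ℤ) :
    G.a * x ^ 2 ≤ 2 * G.eval x y z ∧ G.d * y ^ 2 ≤ 2 * G.eval x y z ∧
      G.f * z ^ 2 ≤ 2 * G.eval x y z := by
  have hdisc := hG.two_mul_le_disc
  obtain ⟨ha, had, hdf, hb, hc, he, -⟩ := hG
  have hb2 := sq_le_sq' (abs_le.1 hb).1 (abs_le.1 hb).2
  have hc2 := sq_le_sq' (abs_le.1 hc).1 (abs_le.1 hc).2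
  have he2 := sq_le_sq' (abs_le.1 he).1 (abs_le.1 he).2
  have hd : 0 < G.d := by linarith
  have hf : 0 < G.f := by linarith
  refine ⟨?_, ?_, ?_⟩
  · have := mul_sq_le_two_mul_eval (G := ⟨G.f, G.e, G.c, G.d, G.b, G.a⟩) hf hd ha
      (by dsimp only; nlinarith) (by simp only [disc] at hdisc ⊢; linarith) z y x
    have h : eval ⟨G.f, G.e, G.c, G.d, G.b, G.a⟩ z y x = G.eval x y z := by
      simp only [eval]; ring
    rwa [h] at this
  · have := mul_sq_le_two_mul_eval (G := ⟨G.a, G.c, G.b, G.f, G.e, G.d⟩) ha hf hd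
      (by dsimp only; nlinarith) (by simp only [disc] at hdisc ⊢; linarith) x z y
    have h : eval ⟨G.a, G.c, G.b, G.f, G.e, G.d⟩ x z y = G.eval x y z := by
      simp only [eval]; ring
    rwa [h] at this
  · exact mul_sq_le_two_mul_eval ha hd hf (by nlinarith) hdisc x y z

/-- The sharper constant on the section `z = 0` matters: values 1 and 2 with `y ≠ 0` force `d ≤ 1`
and `d ≤ 2`. -/
theorem Reduced.three_mul_sq_le {G : TForm} (hG : G.Reduced) (x y : ℤ) :
    3 * (G.d * y ^ 2) ≤ 4 * G.eval x y 0 := by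
  obtain ⟨ha, had, -, hb, -⟩ := hG
  have hb2 := sq_le_sq' (abs_le.1 hb).1 (abs_le.1 hb).2
  have h1 : 0 ≤ (G.a * G.d - G.b ^ 2) * y ^ 2 := mul_nonneg (by nlinarith) (sq_nonneg y)
  have h2 : 4 * G.a * G.eval x y 0 = (2 * G.a * x + G.b * y) ^ 2 +
      (G.a * G.d - G.b ^ 2) * y ^ 2 + G.a * (3 * (G.d * y ^ 2)) := by
    simp only [eval]; ring
  have h3 : G.a * (3 * (G.d * y ^ 2)) ≤ G.a * (4 * G.eval x y 0) := by
    nlinarith [sq_nonneg (2 * G.a * x + G.b * y)]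
  exact le_of_mul_le_mul_left h3 ha

/-- Integers that witness the failure of universality. -/
def witnesses : List ℤ := [1, 2, 3, 5, 6, 7, 10, 13, 14, 17, 21, 22, 23, 29, 31]

/-- The integers of absolute value at most `7`. -/
def box : List ℤ := [0, 1, -1, 2, -2, 3, -3, 4, -4, 5, -5, 6, -6, 7, -7]

theorem mem_box {x : ℤ} : x ∈ box ↔ -7 ≤ x ∧ x ≤ 7 := by
  simp only [box, List.mem_cons, List.not_mem_nil, or_false]; omega

/-- Recognizes the squares below `256`. -/
def isSmallSquare : ℤ → Bool
  | .ofNat k => [0, 1, 4, 9, 16, 25, 36, 49, 64, 81, 100, 121, 144, 169, 196, 225].any (Nat.beq k)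
  | .negSucc _ => false

theorem isSmallSquare_sq {x : ℤ} (hx : x ^ 2 < 16 ^ 2) : isSmallSquare (x ^ 2) = true := by
  have h := abs_lt_of_sq_lt_sq' hx (by norm_num)
  obtain ⟨h1, h2⟩ := h
  interval_cases x <;> rfl

/-- A search that returns `true` only if the reduced form `G` with `G.a ≤ 2` does not represent
`n ≤ 31`: it tests whether `4an` minus the form in `y`, `z` obtained by completing the square in `x`
is a square. -/
def omits (G : TForm) (n : ℤ) : Bool :=
  ([0, 1, 2, 3, 4, 5, 6, 7] : List ℤ).all fun z => !decide (G.f * (z * z) ≤ 2 * n) ||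
    box.all fun y => !decide (G.d * (y * y) ≤ 2 * n) ||
      !isSmallSquare (4 * G.a * n - (((4 * G.a * G.d - G.b * G.b) * y +
        (4 * G.a * G.e - 2 * G.b * G.c) * z) * y + (4 * G.a * G.f - G.c * G.c) * (z * z)))

theorem Reduced.not_rep_of_omits {G : TForm} (hG : G.Reduced) (ha2 : G.a ≤ 2) {n : ℤ}
    (hn : n ≤ 31) (h : omits G n = true) : ¬ G.Rep n := by
  suffices key : ∀ x y z : ℤ, 0 ≤ z → G.eval x y z ≠ n by
    rintro ⟨x, y, z, hv⟩
    rcases le_total 0 z with hz | hz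
    · exact key x y z hz hv
    · refine key (-x) (-y) (-z) (by omega) (Eq.trans ?_ hv)
      simp only [eval]; ring
  intro x y z hz hv
  obtain ⟨-, hy2, hz2⟩ := hG.coord_bounds x y z
  have hdisc := hG.two_mul_le_disc
  have hsquares := G.complete_squares x y z
  obtain ⟨ha, had, hdf, hb, -⟩ := hG
  have hb2 := sq_le_sq' (abs_le.1 hb).1 (abs_le.1 hb).2
  have hd : 0 < G.d := by omega
  have hf : 0 < G.f := by omega
  have hD : 0 < 4 * G.a * G.d - G.b ^ 2 := by nlinarith
  rw [hv] at hy2 hz2 hsquares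
  have hbox : ∀ {s t : ℤ}, 0 < s → s * t ^ 2 ≤ 2 * n → -7 ≤ t ∧ t ≤ 7 := by
    intro s t hs ht
    -- `t² ≤ 2n ≤ 62`.
    have h2 : t ^ 2 < 8 ^ 2 := by nlinarith [sq_nonneg t]
    have := abs_lt_of_sq_lt_sq' h2 (by norm_num)
    omega
  have hzb := hbox hf hz2
  have hX : (2 * G.a * x + G.b * y + G.c * z) ^ 2 ≤ 4 * G.a * n := by
    have h1 : 0 ≤ 4 * G.a * G.disc * z ^ 2 := by
      have : 0 < 2 * G.a * G.d * G.f := by positivity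
      have : 0 < G.disc := by linarith
      positivity
    refine le_of_mul_le_mul_left ?_ hD
    nlinarith [sq_nonneg ((4 * G.a * G.d - G.b ^ 2) * y + (2 * G.a * G.e - G.b * G.c) * z)]
  simp only [omits, List.all_eq_true, Bool.or_eq_true, Bool.not_eq_true', decide_eq_false_iff_not,
    ← sq] at h
  have h1 := ((h z (by simp only [List.mem_cons, List.not_mem_nil, or_false]; omega)).resolve_left
    (not_not.2 hz2) y (mem_box.2 (hbox hd hy2))).resolve_left (not_not.2 hy2)
  -- The square is at most `4an ≤ 4 · 2 · 31 = 248`.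
  have h2 := isSmallSquare_sq (x := 2 * G.a * x + G.b * y + G.c * z) (by nlinarith)
  refine Bool.false_ne_true ?_
  rw [← h1, ← h2]
  congr 1
  rw [← hv]
  simp only [eval]; ring

theorem exists_binary_exception : ∀ a ∈ Finset.Icc (1 : ℤ) 2, ∀ d ∈ Finset.Icc a 4,
    ∀ b ∈ Finset.Icc (-a) a, ∃ n ∈ ([1, 2, 3, 5] : List ℤ),
      ∀ y ∈ Finset.Icc (-3 : ℤ) 3, ∀ x ∈ Finset.Icc (-3 : ℤ) 3,
        a * x ^ 2 + b * (x * y) + d * y ^ 2 ≠ n := by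
  decide +kernel

theorem exists_ternary_exception : ∀ a ∈ Finset.Icc (1 : ℤ) 2, ∀ d ∈ Finset.Icc a 4,
    ∀ f ∈ Finset.Icc d 10, (a = 1 ∨ f ≤ 2) → (d ≤ 2 ∨ f ≤ 4) → ∀ b ∈ Finset.Icc (-a) a,
    ∀ c ∈ Finset.Icc (-a) a, ∀ e ∈ Finset.Icc (-d) d, Reduced ⟨a, b, c, d, e, f⟩ →
      ∃ n ∈ witnesses, omits ⟨a, b, c, d, e, f⟩ n = true := by
  decide +kernel

/-- Representing 1 gives `a = 1` or `f ≤ 2`, and representing 2 gives `d ≤ 2` or `f ≤ 4`. The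
section `z = 0` misses some `n ≤ 5`, so representing it needs `z ≠ 0`, whence `f ≤ 2n ≤ 10`.
Finitely many forms remain. -/
theorem Reduced.exists_not_rep {G : TForm} (hG : G.Reduced) :
    ∃ n ∈ witnesses, ¬ G.Rep n := by
  by_contra! hall
  have hG' := hG
  obtain ⟨ha, had, hdf, hb, hc, he, -⟩ := hG'
  have hd : 0 < G.d := by linarith
  have hf : 0 < G.f := by linarith
  rw [abs_le] at hb hc he
  have le_of_ne : ∀ {s x n : ℤ}, 0 < s → x ≠ 0 → s * x ^ 2 ≤ 2 * n → s ≤ 2 * n := by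
    intro s x n hs hx h
    have : 0 < x ^ 2 := by positivity
    nlinarith
  have ha1 : G.a = 1 ∨ G.f ≤ 2 := by
    obtain ⟨x, y, z, h⟩ := hall 1 (by decide)
    by_cases hz : z = 0
    · subst hz
      have hd' := hG.three_mul_sq_le x y
      rw [h] at hd'
      by_cases hy : y = 0
      · subst hy
        have : G.a * x ^ 2 = 1 := by rw [← h]; simp [eval]
        exact .inl (Int.eq_one_of_dvd_one ha.le ⟨_, this.symm⟩)
      · have : 0 < y ^ 2 := by positivity
        exact .inl (by nlinarith)
    · have := (hG.coord_bounds x y z).2.2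
      rw [h] at this
      exact .inr (le_of_ne hf hz this)
  have hd2 : G.d ≤ 2 ∨ G.f ≤ 4 := by
    rcases ha1 with ha1 | hf2
    swap
    · omega
    obtain ⟨x, y, z, h⟩ := hall 2 (by decide)
    by_cases hz : z = 0
    · subst hz
      have hd' := hG.three_mul_sq_le x y
      rw [h] at hd'
      by_cases hy : y = 0
      · exfalso
        subst hy
        have h2 : x ^ 2 = 2 := by rw [← h]; simp [eval, ha1]
        have h3 : x < 2 := by nlinarith
        have h4 : -2 < x := by nlinarith
        interval_cases x <;> omega
      · have : 0 < y ^ 2 := by positivity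
        exact .inl (by nlinarith)
    · have := (hG.coord_bounds x y z).2.2
      rw [h] at this
      exact .inr (le_of_ne hf hz this)
  have had4 : G.a ≤ 2 ∧ G.d ≤ 4 := by omega
  have hf10 : G.f ≤ 10 := by
    obtain ⟨n, hn, hno⟩ := exists_binary_exception G.a (Finset.mem_Icc.2 ⟨ha, had4.1⟩)
      G.d (Finset.mem_Icc.2 ⟨had, had4.2⟩) G.b (Finset.mem_Icc.2 hb)
    have hsub : ∀ n ∈ ([1, 2, 3, 5] : List ℤ), n ∈ witnesses ∧ n ≤ 5 := by decide
    obtain ⟨hw, hn5⟩ := hsub n hn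
    obtain ⟨x, y, z, h⟩ := hall n hw
    have hv := hG.coord_bounds x y z
    rw [h] at hv
    by_cases hz : z = 0
    · subst hz
      have hbox : ∀ {s t : ℤ}, 0 < s → s * t ^ 2 ≤ 2 * n → t ∈ Finset.Icc (-3 : ℤ) 3 := by
        intro s t hs ht
        have h2 : t ^ 2 < 4 ^ 2 := by nlinarith [sq_nonneg t]
        have := abs_lt_of_sq_lt_sq' h2 (by norm_num)
        exact Finset.mem_Icc.2 (by omega)
      exact absurd (by rw [← h]; simp [eval]) (hno y (hbox hd hv.2.1) x (hbox ha hv.1))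
    · have := le_of_ne hf hz hv.2.2
      omega
  obtain ⟨n, hn, hno⟩ := exists_ternary_exception G.a (Finset.mem_Icc.2 ⟨ha, had4.1⟩)
    G.d (Finset.mem_Icc.2 ⟨had, had4.2⟩) G.f (Finset.mem_Icc.2 ⟨hdf, hf10⟩) ha1 hd2
    G.b (Finset.mem_Icc.2 hb) G.c (Finset.mem_Icc.2 hc) G.e (Finset.mem_Icc.2 he) hG
  have hle : ∀ n ∈ witnesses, n ≤ 31 := by decide
  exact hG.not_rep_of_omits had4.1 (hle n hn) hno (hall n hn)

theorem coprime_of_mem_witnesses {p : ℕ} (hp : p.Prime) (h : p = 19 ∨ 37 ≤ p) {w : ℤ}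
    (hw : w ∈ witnesses) : 0 < w.toNat ∧ w.toNat.Coprime p ∧ (w.toNat : ℤ) = w := by
  have h1 : ∀ w ∈ witnesses, 0 < w ∧ w < 37 ∧ ¬ 19 ∣ w := by decide
  obtain ⟨h2, h3, h4⟩ := h1 w hw
  refine ⟨by omega, ((Nat.Prime.coprime_iff_not_dvd hp).2 fun hd => ?_).symm, by omega⟩
  rcases h with rfl | h
  · omega
  · have := Nat.le_of_dvd (by omega) hd
    omega

/-- Every integral ternary form is given by six coefficients. -/
theorem exists_eq_ternary (Q : IntForm 3) :
    ∃ a b c d e f : ℤ, Q = IntForm.ternary a b c d e f := by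
  refine ⟨Q (Pi.single 0 1), QuadraticMap.polar Q (Pi.single 0 1) (Pi.single 1 1),
    QuadraticMap.polar Q (Pi.single 0 1) (Pi.single 2 1), Q (Pi.single 1 1),
    QuadraticMap.polar Q (Pi.single 1 1) (Pi.single 2 1), Q (Pi.single 2 1), ?_⟩
  ext v
  have hv : v = v 0 • Pi.single 0 1 + v 1 • Pi.single 1 1 + v 2 • Pi.single 2 1 := by
    ext i; fin_cases i <;> simp
  conv_lhs => rw [hv]
  rw [IntForm.ternary_apply, QuadraticMap.map_add (⇑Q), QuadraticMap.map_add (⇑Q) (v 0 • _),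
    QuadraticMap.polar_add_left]
  simp only [QuadraticMap.map_smul, QuadraticMap.polar_smul_left, QuadraticMap.polar_smul_right,
    smul_eq_mul]
  ring

theorem not_coprimeUniversal {p : ℕ} (hp : p.Prime) (h : p = 19 ∨ 37 ≤ p) {Q : IntForm 3}
    (hQ : QuadraticMap.PosDef Q) : ¬ IntForm.CoprimeUniversal p Q := by
  obtain ⟨a, b, c, d, e, f, rfl⟩ := exists_eq_ternary Q
  intro hu
  have hpos : Pos ⟨a, b, c, d, e, f⟩ := by
    refine pos_of_eval_pos fun x y z hv => ?_
    have := hQ ![x, y, z] fun h0 => hv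
      ⟨congrFun h0 0, congrFun h0 1, congrFun h0 2⟩
    rwa [IntForm.ternary_apply] at this
  obtain ⟨H, hGH, hH⟩ := hpos.exists_reduced
  obtain ⟨w, hw, hno⟩ := hH.exists_not_rep
  obtain ⟨h1, h2, h3⟩ := coprime_of_mem_witnesses hp h hw
  have := (represents_ternary_iff _ _ _ _ _ _ _).1 (hu _ h1 h2)
  rw [h3] at this
  exact hno ((hGH.rep_iff _).2 this)

end TForm

theorem IntForm.IsEscalator.posDef {p r : ℕ} {Q : IntForm r} (h : IntForm.IsEscalator p Q)
    (hr : 0 < r) : QuadraticMap.PosDef Q := by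
  cases h with
  | zero => exact absurd hr (lt_irrefl 0)
  | step _ _ _ _ _ h => exact h.1

/-! ### The tabulated forms and existence. -/

namespace TForm

/-- Here and below `r` is a prime congruent to 3 mod 4 modulo which `p` is a nonresidue. -/
theorem representsAllowed_five : RepresentsAllowed 5 1 ⟨1, 0, 5, 2, 1, 7⟩ :=
  classified_five.representsAllowed (r := 3) (by norm_num) (by decide) rfl (by norm_num)

theorem representsAllowed_seven : RepresentsAllowed 7 1 ⟨1, 0, 4, 2, 1, 5⟩ :=
  classified_seven.representsAllowed (r := 11) (by norm_num) (by decide) rfl (by norm_num)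

theorem representsAllowed_eleven : RepresentsAllowed 11 1 ⟨1, 0, 1, 1, 0, 3⟩ :=
  classified_eleven.representsAllowed (r := 3) (by norm_num) (by decide) rfl (by norm_num)

theorem representsAllowed_thirteen : RepresentsAllowed 13 1 ⟨1, 0, 3, 2, 3, 5⟩ :=
  classified_thirteen.representsAllowed (r := 7) (by norm_num) (by decide) rfl (by norm_num)

theorem representsAllowed_seventeen : RepresentsAllowed 17 1 ⟨1, 1, 1, 2, 2, 3⟩ :=
  classified_seventeen.representsAllowed (r := 3) (by norm_num) (by decide) rfl (by norm_num)

theorem representsAllowed_ten : RepresentsAllowed 5 2 ⟨1, 1, 2, 2, 3, 3⟩ :=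
  representsAllowed_five.transfer (c := 2) transfer_ten (by norm_num) (by decide)

theorem representsAllowed_fifteen : RepresentsAllowed 5 3 ⟨1, 0, 4, 2, 3, 7⟩ :=
  representsAllowed_five.transfer (c := 3) transfer_fifteen (by norm_num) (by decide)

theorem representsAllowed_twenty : RepresentsAllowed 5 4 ⟨1, 0, 4, 2, 2, 7⟩ :=
  (representsAllowed_five.transfer (c := 1) transfer_twenty (by norm_num) (by decide)).four_mul
    (by decide)

theorem representsAllowed_twenty_nonclassical : RepresentsAllowed 5 4 ⟨1, 1, 0, 2, 1, 3⟩ :=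
  (representsAllowed_five.transfer (c := 1) transfer_twenty_nonclassical (by norm_num)
    (by decide)).four_mul (by decide)

theorem representsAllowed_forty : RepresentsAllowed 5 8 ⟨1, 0, 0, 2, 4, 7⟩ :=
  (representsAllowed_ten.transfer (c := 1) transfer_forty (by norm_num) (by decide)).four_mul
    (by decide)

theorem representsAllowed_twentyOne : RepresentsAllowed 7 3 ⟨1, 0, 3, 2, 1, 5⟩ :=
  representsAllowed_seven.transfer (c := 3) transfer_twentyOne (by norm_num) (by decide)

theorem provenTable_properties (p : ℕ) (Q : IntForm 3) (h : (p, Q) ∈ IntForm.provenTable) :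
    QuadraticMap.PosDef Q ∧ Q.IsRegular ∧
      (∀ n : ℕ, 0 < n → n.Coprime p → Q.LocallyRepresents n) ∧ IntForm.CoprimeUniversal p Q := by
  simp only [IntForm.provenTable, List.mem_cons, Prod.mk.injEq, List.not_mem_nil, or_false] at h
  rcases h with ⟨rfl, rfl⟩ | ⟨rfl, rfl⟩ | ⟨rfl, rfl⟩ | ⟨rfl, rfl⟩ | ⟨rfl, rfl⟩ | ⟨rfl, rfl⟩ |
    ⟨rfl, rfl⟩ | ⟨rfl, rfl⟩ | ⟨rfl, rfl⟩ | ⟨rfl, rfl⟩ | ⟨rfl, rfl⟩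
  · exact representsAllowed_five.properties (by norm_num) (by decide) rfl (by decide) (by decide)
      (by norm_num)
  · exact representsAllowed_fifteen.properties (by norm_num) (by decide) rfl (by decide) (by decide)
      (by norm_num)
  · exact representsAllowed_twenty.properties (by norm_num) (by decide) rfl (by decide) (by decide)
      (by norm_num)
  · exact representsAllowed_forty.properties (by norm_num) (by decide) rfl (by decide) (by decide)
      (by norm_num)
  · exact representsAllowed_ten.properties (by norm_num) (by decide) rfl (by decide) (by decide)
      (by norm_num)
  · exact representsAllowed_twenty_nonclassical.properties (by norm_num) (by decide) rfl (by decide)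
      (by decide) (by norm_num)
  · exact representsAllowed_seven.properties (by norm_num) (by decide) rfl (by decide) (by decide)
      (by norm_num)
  · exact representsAllowed_twentyOne.properties (by norm_num) (by decide) rfl (by decide)
      (by decide) (by norm_num)
  · exact representsAllowed_eleven.properties (by norm_num) (by decide) rfl (by decide) (by decide)
      (by norm_num)
  · exact representsAllowed_thirteen.properties (by norm_num) (by decide) rfl (by decide)
      (by decide) (by norm_num)
  · exact representsAllowed_seventeen.properties (by norm_num) (by decide) rfl (by decide)
      (by decide) (by norm_num)

/-- Serves `p = 2` and `p = 3`, where regularity is not claimed; only values prime to `p` matter, so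
`p` need not be odd. -/
theorem Classified.exists_coprimeUniversal {p r : ℕ} {a b c d e f : ℤ}
    {L : List (TForm × ℕ × List IntMat)} (h : Classified p ⟨a, b, c, d, e, f⟩ L) (hp : p.Prime)
    (hr4 : r % 4 = 3) (hr : jacobiSym p r = -1) (hpos : Pos ⟨a, b, c, d, e, f⟩) :
    ∃ Q : IntForm 3, QuadraticMap.PosDef Q ∧ IntForm.CoprimeUniversal p Q := by
  refine ⟨IntForm.ternary a b c d e f, hpos.posDef_ternary, fun n hn hc => ?_⟩
  obtain ⟨G, hG, hd, ha⟩ := exists_pos_disc_eq hp hr4 hr hn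
    ((Nat.Prime.coprime_iff_not_dvd hp).1 hc.symm)
  exact (represents_ternary_iff _ _ _ _ _ _ _).2
    (h.rep hG hd ⟨1, 0, 0, by simp [eval, ha]⟩)

theorem exists_coprimeUniversal_of_provenTable {p : ℕ} {Q : IntForm 3}
    (h : (p, Q) ∈ IntForm.provenTable) :
    ∃ Q : IntForm 3, QuadraticMap.PosDef Q ∧ IntForm.CoprimeUniversal p Q :=
  have h' := provenTable_properties p Q h
  ⟨Q, h'.1, h'.2.2.2⟩

end TForm

theorem theorem3p1 :
    (∀ (p : ℕ) (Q : IntForm 3), (p, Q) ∈ IntForm.provenTable →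
      QuadraticMap.PosDef Q ∧ Q.IsRegular ∧
        (∀ n : ℕ, 0 < n → n.Coprime p → Q.LocallyRepresents n) ∧
        IntForm.CoprimeUniversal p Q) ∧
    (∀ p : ℕ, p.Prime → (p = 19 ∨ 37 ≤ p) →
      (∀ Q : IntForm 3, IntForm.IsEscalator p Q → (IntForm.coprimeExceptions p Q).Nonempty) ∧
        ¬ ∃ Q : IntForm 3, QuadraticMap.PosDef Q ∧ IntForm.CoprimeUniversal p Q) ∧
    (∀ p ∈ ({2, 3, 5, 7, 11, 13, 17} : Set ℕ),
      ∃ Q : IntForm 3, QuadraticMap.PosDef Q ∧ IntForm.CoprimeUniversal p Q) ∧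
    (∀ p ∈ ({23, 29, 31} : Set ℕ), IntForm.ConjectureAt p →
      ∃ Q : IntForm 3, QuadraticMap.PosDef Q ∧ IntForm.CoprimeUniversal p Q) := by
  refine ⟨TForm.provenTable_properties, fun p hp h => ⟨fun Q hQ => ?_, ?_⟩,
    ?_, ?_⟩
  · have hno := TForm.not_coprimeUniversal hp h (hQ.posDef (by norm_num))
    simp only [IntForm.CoprimeUniversal] at hno
    push Not at hno
    exact hno
  · rintro ⟨Q, hQ, hu⟩
    exact TForm.not_coprimeUniversal hp h hQ hu
  · rintro p (rfl | rfl | rfl | rfl | rfl | rfl | rfl)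
    · exact TForm.classified_two.exists_coprimeUniversal (r := 3) Nat.prime_two rfl (by norm_num)
        ⟨by decide, by decide, by decide⟩
    · exact TForm.classified_three.exists_coprimeUniversal (r := 7) Nat.prime_three rfl
        (by norm_num) ⟨by decide, by decide, by decide⟩
    · exact TForm.exists_coprimeUniversal_of_provenTable (Q := IntForm.ternary 1 0 5 2 1 7)
        (by simp [IntForm.provenTable])
    · exact TForm.exists_coprimeUniversal_of_provenTable (Q := IntForm.ternary 1 0 4 2 1 5)
        (by simp [IntForm.provenTable])
    · exact TForm.exists_coprimeUniversal_of_provenTable (Q := IntForm.ternary 1 0 1 1 0 3)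
        (by simp [IntForm.provenTable])
    · exact TForm.exists_coprimeUniversal_of_provenTable (Q := IntForm.ternary 1 0 3 2 3 5)
        (by simp [IntForm.provenTable])
    · exact TForm.exists_coprimeUniversal_of_provenTable (Q := IntForm.ternary 1 1 1 2 2 3)
        (by simp [IntForm.provenTable])
  · rintro p (rfl | rfl | rfl) hconj
    · exact ⟨IntForm.ternary 1 0 2 2 3 5, TForm.Pos.posDef_ternary ⟨by decide, by decide, by decide⟩,
        hconj _ (by simp [IntForm.conjecturedTable])⟩
    · exact ⟨IntForm.ternary 1 0 1 2 3 5, TForm.Pos.posDef_ternary ⟨by decide, by decide, by decide⟩,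
        hconj _ (by simp [IntForm.conjecturedTable])⟩
    · exact ⟨IntForm.ternary 1 0 2 2 1 5, TForm.Pos.posDef_ternary ⟨by decide, by decide, by decide⟩,
        hconj _ (by simp [IntForm.conjecturedTable])⟩
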